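/- Write $x=(x_1,x_2,x_3)\in\mathbb{R}^3$ and $|x'|=\sqrt{x_1^2+x_2^2}$. Let $D^{1,2}(\mathbb{R}^3)$ and $D^{1,2}(\mathbb{R}^3,\mathbb{R}^3)$ be the completions (inside $L^6$) of the smooth compactly supported functions, respectively vector fields, with respect to $\|\nabla\cdot\|_{L^2}$. Let $X_{\mathcal{SO}}$ be the set of $u\in D^{1,2}(\mathbb{R}^3)$ with $\int_{\mathbb{R}^3}|u|^2/|x'|^2\,dx<\infty$ that are invariant under $\mathcal{SO}:=\mathcal{O}(2)\times\{I\}\subset\mathcal{O}(3)$, and let $\mathcal{D}_{\mathcal{F}}$ be the set of $\mathbf{u}\in D^{1,2}(\mathbb{R}^3,\mathbb{R}^3)$ of the form $\mathbf{u}(x)=\frac{u(x)}{|x'|}(-x_2,x_1,0)$ (for almost every $x$) with an $\mathcal{SO}$-invariant function $u:\mathbb{R}^3\to\mathbb{R}$. **Theorem.** Let $0\le s_2<s_1<2$ and $a_0=\frac{s_1-s_2}{(2-s_2)(3-s_1)}$. Then there is a smallest constant $\bar S\geq 0$ such that, for all $u\in X_{\mathcal{SO}}$, $$\left(\int_{\mathbb{R}^3}\frac{|u|^{6-2s_1}}{|x|^{s_1}}dx\right)^{\frac1{6-2s_1}}\le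 \bar S\left(\int_{\mathbb{R}^3}|\nabla u|^2+\frac{|u|^2}{|x'|^2}dx\right)^{\frac{a_0}2}\left(\int_{\mathbb{R}^3}\frac{|u|^{6-2s_2}}{|x|^{s_2}}dx\right)^{\frac{1-a_0}{6-2s_2}},$$ and the number $$\lambda^*:=-\frac{2-s_1}{2-s_2}\,\bar S^{\,6-2s_1}\left(\frac{s_1-s_2}{2-s_2}\,\bar S^{\,6-2s_1}\right)^{\frac{(2-s_1)(s_1-s_2)}{(2-s_2)^2}}$$ is negative. If $\lambda<\lambda^*$, then $\mathbf{u}=0$ is the only weak solution in $\mathcal{D}_{\mathcal{F}}$ (up to equality almost everywhere) of $$\nabla\times(\nabla\times\mathbf{u})=\frac{|\mathbf{u}|^{4-2s_1}\mathbf{u}}{|x|^{s_1}}+\lambda\,\frac{|\mathbf{u}|^{4-2s_2}\mathbf{u}}{|x|^{s_2}}\quad\text{in }\mathbb{R}^3,$$ where weak solution means that for all $\Phi\in C_c^\infty(\mathbb{R}^3,\mathbb{R}^3)$ $$\int_{\mathbb{R}^3}(\nabla\times\mathbf{u})\cdot(\nabla\times\Phi)\,dx=\int_{\mathbb{R}^3}\frac{|\mathbf{u}|^{4-2s_1}\,\mathbf{u}\cdot\Phi}{|x|^{s_1}}dx+\lambda\int_{\mathbb{R}^3}\frac{|\mathbf{u}|^{4-2s_2}\,\mathbf{u}\cdot\Phi}{|x|^{s_2}}dx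 .$$ -/

import Mathlib

open MeasureTheory Filter Topology
open scoped ContDiff ENNReal

noncomputable section

namespace Maxwell

/-- Euclidean space `ℝ³`; the coordinates `x₁, x₂, x₃` are `x 0, x 1, x 2`. -/
abbrev E3 : Type := EuclideanSpace ℝ (Fin 3)

/-- `|x'| = √(x₁² + x₂²)`, the distance to the `x₃`-axis. -/
def axisDist (x : E3) : ℝ := Real.sqrt (x 0 ^ 2 + x 1 ^ 2)

/-- The partial derivative `∂_j φ (x)` of a differentiable map on `ℝ³`. -/
def partialDeriv {F : Type*} [NormedAddCommGroup F] [NormedSpace ℝ F]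
    (φ : E3 → F) (j : Fin 3) (x : E3) : F :=
  fderiv ℝ φ x (EuclideanSpace.single j 1)

/-- `u` belongs to `D^{1,2}(ℝ³, F)`, the completion of `C_c^∞(ℝ³, F)` for `‖∇φ‖_{L²}` realized
inside `L⁶`, and `G j` is its partial derivative `∂_j u`: some sequence of test functions tends
to `u` in `L⁶` while its partial derivatives tend to the `G j` in `L²`. Up to null sets `G` is
determined by `u` (it is the weak gradient of `u`). -/
def HasD12Gradient {F : Type*} [NormedAddCommGroup F] [NormedSpace ℝ F]
    (u : E3 → F) (G : Fin 3 → E3 → F) : Prop :=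
  MemLp u 6 volume ∧ (∀ j, MemLp (G j) 2 volume) ∧
    ∃ φ : ℕ → E3 → F,
      (∀ n, ContDiff ℝ ∞ (φ n) ∧ HasCompactSupport (φ n)) ∧
      Tendsto (fun n => eLpNorm (fun x => φ n x - u x) 6 volume) atTop (𝓝 0) ∧
      ∀ j, Tendsto (fun n => eLpNorm (fun x => partialDeriv (φ n) j x - G j x) 2 volume)
        atTop (𝓝 0)

/-- Invariance of a scalar function under `O(2) × {I}`, the group of the linear isometries of
`ℝ³` that keep the third coordinate. -/
def IsSOInvariant (u : E3 → ℝ) : Prop :=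
  ∀ g : E3 ≃ₗᵢ[ℝ] E3, (∀ x, g x 2 = x 2) → ∀ x, u (g x) = u x

/-- `u` belongs to `X_SO` and `G` is its gradient: `u ∈ D^{1,2}(ℝ³)`, `∫ |u|²/|x'|² < ∞`, and
`u` is invariant under `O(2) × {I}`. -/
def MemXSO (u : E3 → ℝ) (G : Fin 3 → E3 → ℝ) : Prop :=
  HasD12Gradient u G ∧ Integrable (fun x => u x ^ 2 / axisDist x ^ 2) volume ∧ IsSOInvariant u

/-- `∫ |∇u|² + |u|²/|x'|² dx`. -/
def energy (u : E3 → ℝ) (G : Fin 3 → E3 → ℝ) : ℝ :=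
  ∫ x, ((∑ j, G j x ^ 2) + u x ^ 2 / axisDist x ^ 2)

/-- `∫ |u|^{6-2s} / |x|^s dx`. It is finite for `0 ≤ s < 2` and `u` in `X_SO`, since then `u` is
in `L⁶` and `u/|x|` in `L²`. -/
def weightedIntegral (s : ℝ) (u : E3 → ℝ) : ℝ :=
  ∫ x, |u x| ^ (6 - 2 * s) / ‖x‖ ^ s

/-- The exponent `a₀ = (s₁ - s₂) / ((2 - s₂)(3 - s₁))`. -/
def cknExponent (s₁ s₂ : ℝ) : ℝ := (s₁ - s₂) / ((2 - s₂) * (3 - s₁))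

/-- The constants `S ≥ 0` admissible in the Caffarelli-Kohn-Nirenberg type inequality
`(∫ |u|^{6-2s₁}/|x|^{s₁})^{1/(6-2s₁)}
  ≤ S (∫ |∇u|² + |u|²/|x'|²)^{a₀/2} (∫ |u|^{6-2s₂}/|x|^{s₂})^{(1-a₀)/(6-2s₂)}` on `X_SO`. -/
def cknConstants (s₁ s₂ : ℝ) : Set ℝ :=
  {S : ℝ | 0 ≤ S ∧ ∀ (u : E3 → ℝ) (G : Fin 3 → E3 → ℝ), MemXSO u G →
    weightedIntegral s₁ u ^ (1 / (6 - 2 * s₁)) ≤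
      S * energy u G ^ (cknExponent s₁ s₂ / 2) *
        weightedIntegral s₂ u ^ ((1 - cknExponent s₁ s₂) / (6 - 2 * s₂))}

/-- The best constant in the Caffarelli-Kohn-Nirenberg type inequality. -/
def Sbar (s₁ s₂ : ℝ) : ℝ := sInf (cknConstants s₁ s₂)

/-- The number `λ*`. -/
def lambdaStar (s₁ s₂ : ℝ) : ℝ :=
  -((2 - s₁) / (2 - s₂)) * Sbar s₁ s₂ ^ (6 - 2 * s₁) *
    ((s₁ - s₂) / (2 - s₂) * Sbar s₁ s₂ ^ (6 - 2 * s₁)) ^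
      ((2 - s₁) * (s₁ - s₂) / (2 - s₂) ^ 2)

/-- The curl of a vector field with partial derivatives `G j = ∂_j U`; the component `∂_j U_i` at
the point `x` is `G j x i`. -/
def curl (G : Fin 3 → E3 → E3) (x : E3) : E3 :=
  !₂[G 1 x 2 - G 2 x 1, G 2 x 0 - G 0 x 2, G 0 x 1 - G 1 x 0]

/-- The space `D_F = D^{1,2}(ℝ³, ℝ³) ∩ F`: the fields `U` in `D^{1,2}(ℝ³, ℝ³)` of the form
`U = (u/|x'|) (-x₂, x₁, 0)` (almost everywhere) with an `O(2) × {I}`-invariant scalar `u`. -/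
def MemDF (U : E3 → E3) : Prop :=
  (∃ G : Fin 3 → E3 → E3, HasD12Gradient U G) ∧
    ∃ u : E3 → ℝ, IsSOInvariant u ∧
      U =ᵐ[volume] fun x => (u x / axisDist x) • (!₂[-(x 1), x 0, 0] : E3)

/-- `U ∈ D^{1,2}(ℝ³, ℝ³)` is a weak solution of
`∇ × (∇ × U) = |U|^{4-2s₁} U / |x|^{s₁} + λ |U|^{4-2s₂} U / |x|^{s₂}` in `ℝ³`. -/
def IsWeakSolution (s₁ s₂ lam : ℝ) (U : E3 → E3) : Prop :=
  ∃ G : Fin 3 → E3 → E3, HasD12Gradient U G ∧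
    ∀ Φ : E3 → E3, ContDiff ℝ ∞ Φ → HasCompactSupport Φ →
      ∫ x, inner ℝ (curl G x) (curl (partialDeriv Φ) x) =
        (∫ x, ‖U x‖ ^ (4 - 2 * s₁) / ‖x‖ ^ s₁ * inner ℝ (U x) (Φ x)) +
          lam * ∫ x, ‖U x‖ ^ (4 - 2 * s₂) / ‖x‖ ^ s₂ * inner ℝ (U x) (Φ x)

end Maxwell

end

noncomputable section

namespace Maxwell

/-! ### Convergence in `L^p` -/

section Lp

variable {α F : Type*} [MeasurableSpace α] {μ : Measure α} [NormedAddCommGroup F]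

/-! Write `r = |x'|` and `e_r`, `e_φ` for the radial and angular unit vectors, so that `U = u e_φ`.
Invariance of `u` makes `U` divergence free, hence `∫ |curl U|² = ∫ |∇U|²`, and the turning of `e_φ`
contributes `u²/r²` next to `|∇u|²`. So the energy `E` of `u` is at most `∫ |curl U|²`
(`HasD12Gradient.energy_le_of_toroidal`). Testing the equation with `U` itself
(`integral_inner_curl_eq_of_weak`) gives `E ≤ W₁ + λ W₂`, where `W₁`, `W₂` are the weighted
integrals for `s₁`, `s₂`. The Caffarelli-Kohn-Nirenberg inequality followed by Young's inequality
gives `W₁ ≤ E - λ* W₂` (`MemXSO.weightedIntegral_le_energy_sub`). Together `0 ≤ (λ - λ*) W₂`, so `W₂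
= 0` and `u = 0` almost everywhere.

The Caffarelli-Kohn-Nirenberg inequality is Hölder interpolation in `s` between `W₂` and `∫ u²/|x|²
≤ E`. It holds with constant `1`, so `S̄ ≤ 1`. With `θ = (s₁-s₂)/(2-s₂)`, the number `λ*` carries
the exponent `θ(1-θ)` where optimal Young would give `θ/(1-θ)`; since `θ S̄^{6-2s₁} ≤ 1`, this only
weakens the inequality (`mul_rpow_le_add`).

The analytic difficulty is the axis, where `e_φ` is singular. Distributional identities are tested
off the axis, a null set. An invariant function is weakly constant in the angle
(`integral_mul_angularDeriv_eq_zero`), so the angular derivative of `U` is `-u e_r`; this yields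
`|u|/r ≤ |∇U|` pointwise and thus `U/r ∈ L²`. Cutoffs with gradient of size `C/r` can then remove
the axis and infinity (`HasD12Gradient.exists_approx_offAxis`). The resulting test functions serve
twice: to place `u` in `X_SO`, and to test the equation with `U`. -/

instance holderTriple_three_six_two : ENNReal.HolderTriple 3 6 2 := by
  constructor
  rw [← ENNReal.toReal_eq_toReal_iff' (by simp) (by simp), ENNReal.toReal_add (by simp) (by simp)]
  norm_num

/-- This triple pairs test functions with `L⁶` functions in the weak gradient identity; the triple
`3, 6, 2` turns `L⁶` convergence into `L²` convergence after multiplication by a compactly supported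
factor. -/
instance holderTriple_six_fifths_six_one : ENNReal.HolderTriple (6 / 5) 6 1 := by
  constructor
  have h : (6 / 5 : ℝ≥0∞) ≠ 0 := by simp
  rw [← ENNReal.toReal_eq_toReal_iff' (by simp) (by simp), ENNReal.toReal_add (by simp) (by simp)]
  norm_num

/-- Convergence of the integrals of products, for Hölder conjugate exponents. -/
theorem tendsto_integral_mul {p q : ℝ≥0∞} [ENNReal.HolderTriple p q 1]
    {f g : α → ℝ} {fn gn : ℕ → α → ℝ}
    (hf : MemLp f p μ) (hg : MemLp g q μ) (hfn : ∀ n, MemLp (fn n) p μ)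
    (hgn : ∀ n, MemLp (gn n) q μ)
    (hf' : Tendsto (fun n => eLpNorm (fun x => fn n x - f x) p μ) atTop (𝓝 0))
    (hg' : Tendsto (fun n => eLpNorm (fun x => gn n x - g x) q μ) atTop (𝓝 0)) :
    Tendsto (fun n => ∫ x, fn n x * gn n x ∂μ) atTop (𝓝 (∫ x, f x * g x ∂μ)) := by
  have hmul {a b : α → ℝ} (ha : MemLp a p μ) (hb : MemLp b q μ) :
      eLpNorm (fun x => a x * b x) 1 μ ≤ eLpNorm a p μ * eLpNorm b q μ := by
    have h := eLpNorm_smul_le_mul_eLpNorm (p := p) (q := q) (r := 1) (f := b) (φ := a) hb.1 ha.1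
    exact h
  refine tendsto_integral_of_L1' _ (hf.1.mul hg.1)
    (Eventually.of_forall fun n => memLp_one_iff_integrable.1 ((hgn n).smul (r := 1) (hfn n))) ?_
  have hlim : Tendsto (fun n => eLpNorm (fun x => fn n x - f x) p μ *
        eLpNorm (fun x => gn n x - g x) q μ + eLpNorm f p μ * eLpNorm (fun x => gn n x - g x) q μ +
        eLpNorm (fun x => fn n x - f x) p μ * eLpNorm g q μ) atTop (𝓝 0) := by
    have h1 := ENNReal.Tendsto.mul hf' (Or.inr ENNReal.zero_ne_top) hg' (Or.inr ENNReal.zero_ne_top)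
    have h2 := ENNReal.Tendsto.const_mul hg' (Or.inr hf.2.ne)
    have h3 := ENNReal.Tendsto.mul_const hf' (Or.inr hg.2.ne)
    simpa using (h1.add h2).add h3
  refine tendsto_of_tendsto_of_tendsto_of_le_of_le tendsto_const_nhds hlim (fun _ => zero_le) ?_
  intro n
  have hfd := (hfn n).sub hf
  have hgd := (hgn n).sub hg
  have heq : ((fun x => fn n x * gn n x) - fun x => f x * g x) =
      ((fun x => (fn n x - f x) * (gn n x - g x)) + fun x => f x * (gn n x - g x)) +
        fun x => (fn n x - f x) * g x := by
    funext x; simp only [Pi.sub_apply, Pi.add_apply]; ring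
  change eLpNorm ((fun x => fn n x * gn n x) - fun x => f x * g x) 1 μ ≤ _
  rw [heq]
  refine (eLpNorm_add_le ((hfd.1.mul hgd.1).add (hf.1.mul hgd.1)) (hfd.1.mul hg.1) le_rfl).trans ?_
  refine add_le_add ((eLpNorm_add_le (hfd.1.mul hgd.1) (hf.1.mul hgd.1) le_rfl).trans ?_)
    (hmul hfd hg)
  exact add_le_add (hmul hfd hgd) (hmul hf hgd)

/-- Dominated convergence in `L^p`. -/
theorem tendsto_eLpNorm_zero_of_dominated {p : ℝ≥0∞} (hp0 : p ≠ 0) (hp : p ≠ ⊤) {f : ℕ → α → F}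
    (hf : ∀ n, AEStronglyMeasurable (f n) μ) {b : α → ℝ} (hb : MemLp b p μ)
    (hfb : ∀ n, ∀ᵐ x ∂μ, ‖f n x‖ ≤ b x)
    (hlim : ∀ᵐ x ∂μ, ∀ᶠ n in atTop, f n x = 0) :
    Tendsto (fun n => eLpNorm (f n) p μ) atTop (𝓝 0) := by
  have hpos : 0 < p.toReal := ENNReal.toReal_pos hp0 hp
  simp only [eLpNorm_eq_lintegral_rpow_enorm_toReal hp0 hp]
  have h := tendsto_lintegral_of_dominated_convergence' (μ := μ)
    (F := fun n x => ‖f n x‖ₑ ^ p.toReal) (f := fun _ => 0) (fun x => ‖b x‖ₑ ^ p.toReal)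
    (fun n => (hf n).enorm.pow_const _) ?_ ?_ ?_
  · have := h.ennrpow_const (1 / p.toReal)
    simpa [hpos] using this
  · intro n
    filter_upwards [hfb n] with x hx
    refine ENNReal.rpow_le_rpow ?_ hpos.le
    exact enorm_le_iff_norm_le.2 (hx.trans (le_abs_self _))
  · exact (lintegral_rpow_enorm_lt_top_of_eLpNorm_lt_top hp0 hp hb.2).ne
  · filter_upwards [hlim] with x hx
    refine tendsto_const_nhds.congr' ?_
    filter_upwards [hx] with n hn
    simp [hn, hpos]

end Lp

/-! ### Coordinates -/

theorem norm_sq_eq_sum (x : E3) : ‖x‖ ^ 2 = x 0 ^ 2 + x 1 ^ 2 + x 2 ^ 2 := by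
  rw [EuclideanSpace.norm_sq_eq, Fin.sum_univ_three]; simp

theorem inner_eq_sum (x y : E3) : inner ℝ x y = x 0 * y 0 + x 1 * y 1 + x 2 * y 2 := by
  simp [PiLp.inner_apply, Fin.sum_univ_three]; ring

theorem abs_coord_le_norm (x : E3) (i : Fin 3) : |x i| ≤ ‖x‖ := by
  simpa using PiLp.norm_apply_le x i

theorem axisDist_nonneg (x : E3) : 0 ≤ axisDist x := Real.sqrt_nonneg _

theorem axisDist_sq (x : E3) : axisDist x ^ 2 = x 0 ^ 2 + x 1 ^ 2 := Real.sq_sqrt (by positivity)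

theorem axisDist_le_norm (x : E3) : axisDist x ≤ ‖x‖ := by
  refine abs_le_of_sq_le_sq' ?_ (norm_nonneg _) |>.2
  rw [axisDist_sq, norm_sq_eq_sum]
  nlinarith [sq_nonneg (x 2)]

theorem abs_coord_zero_le_axisDist (x : E3) : |x 0| ≤ axisDist x :=
  Real.abs_le_sqrt (by nlinarith [sq_nonneg (x 1)])

theorem abs_coord_one_le_axisDist (x : E3) : |x 1| ≤ axisDist x :=
  Real.abs_le_sqrt (by nlinarith [sq_nonneg (x 0)])

@[fun_prop]
theorem contDiff_coord (i : Fin 3) : ContDiff ℝ ∞ fun x : E3 => x i :=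
  (EuclideanSpace.proj (𝕜 := ℝ) i).contDiff

@[fun_prop]
theorem continuous_coord (i : Fin 3) : Continuous fun x : E3 => x i :=
  (contDiff_coord i).continuous

@[fun_prop]
theorem continuous_axisDist : Continuous axisDist := by
  unfold axisDist; fun_prop

theorem ae_axisDist_pos : ∀ᵐ x : E3, 0 < axisDist x := by
  let S : Submodule ℝ E3 := LinearMap.ker (EuclideanSpace.proj (𝕜 := ℝ) (0 : Fin 3)).toLinearMap
  have hS : S ≠ ⊤ := by
    intro h
    have : EuclideanSpace.single (0 : Fin 3) (1 : ℝ) ∈ S := h ▸ Submodule.mem_top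
    simp [S] at this
  have h0 := Measure.addHaar_submodule (volume : Measure E3) S hS
  filter_upwards [measure_eq_zero_iff_ae_notMem.1 h0] with x hx
  have hx0 : x 0 ≠ 0 := by simpa [S] using hx
  exact Real.sqrt_pos.2 (by positivity)

theorem partialDeriv_coord (i j : Fin 3) (x : E3) :
    partialDeriv (fun y : E3 => y i) j x = if i = j then 1 else 0 := by
  have h : HasFDerivAt (fun y : E3 => y i) (EuclideanSpace.proj (𝕜 := ℝ) i) x :=
    (EuclideanSpace.proj (𝕜 := ℝ) i).hasFDerivAt
  simp [partialDeriv, h.fderiv]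

section PartialDeriv

variable {F : Type*} [NormedAddCommGroup F] [NormedSpace ℝ F]

theorem partialDeriv_smul {f : E3 → ℝ} {g : E3 → F} {x : E3} (hf : DifferentiableAt ℝ f x)
    (hg : DifferentiableAt ℝ g x) (j : Fin 3) :
    partialDeriv (fun y => f y • g y) j x = f x • partialDeriv g j x + partialDeriv f j x • g x := by
  simp [partialDeriv, fderiv_fun_smul hf hg]

theorem partialDeriv_mul {f g : E3 → ℝ} {x : E3} (hf : DifferentiableAt ℝ f x)
    (hg : DifferentiableAt ℝ g x) (j : Fin 3) :
    partialDeriv (fun y => f y * g y) j x = f x * partialDeriv g j x + partialDeriv f j x * g x := by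
  simp [partialDeriv, fderiv_fun_mul hf hg, mul_comm]

theorem partialDeriv_apply {f : E3 → E3} {x : E3} (hf : DifferentiableAt ℝ f x) (i j : Fin 3) :
    partialDeriv (fun y => f y i) j x = partialDeriv f j x i := by
  have h := ((EuclideanSpace.proj (𝕜 := ℝ) i).hasFDerivAt (x := f x)).comp x hf.hasFDerivAt
  have h' : HasFDerivAt (fun y => f y i) ((EuclideanSpace.proj (𝕜 := ℝ) i).comp (fderiv ℝ f x)) x := h
  simp [partialDeriv, h'.fderiv]

theorem contDiff_partialDeriv {f : E3 → F} (hf : ContDiff ℝ ∞ f) (j : Fin 3) :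
    ContDiff ℝ ∞ (partialDeriv f j) :=
  (hf.fderiv_right (m := ∞) (by simp)).clm_apply contDiff_const

theorem hasCompactSupport_partialDeriv {f : E3 → F} (hf : HasCompactSupport f) (j : Fin 3) :
    HasCompactSupport (partialDeriv f j) :=
  hf.fderiv_apply (𝕜 := ℝ) (EuclideanSpace.single j 1)

theorem integral_mul_partialDeriv {f g : E3 → ℝ} (hf : ContDiff ℝ ∞ f) (hg : ContDiff ℝ ∞ g)
    (hgc : HasCompactSupport g) (j : Fin 3) :
    ∫ x, f x * partialDeriv g j x = -∫ x, partialDeriv f j x * g x := by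
  have hf' := (contDiff_partialDeriv hf j).continuous
  have hg' := (contDiff_partialDeriv hg j).continuous
  refine integral_mul_fderiv_eq_neg_fderiv_mul_of_integrable ?_ ?_ ?_
    (fun x _ => hf.differentiable (by simp) x) (fun x _ => hg.differentiable (by simp) x)
  · exact (hf'.mul hg.continuous).integrable_of_hasCompactSupport hgc.mul_left
  · exact (hf.continuous.mul hg').integrable_of_hasCompactSupport
      (hasCompactSupport_partialDeriv hgc j).mul_left
  · exact (hf.continuous.mul hg.continuous).integrable_of_hasCompactSupport hgc.mul_left

end PartialDeriv

/-! ### The space `D^{1,2}` -/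

theorem memLp_coord {f : E3 → E3} {p : ℝ≥0∞} (hf : MemLp f p volume) (i : Fin 3) :
    MemLp (fun x => f x i) p volume :=
  hf.of_le ((EuclideanSpace.proj (𝕜 := ℝ) i).continuous.comp_aestronglyMeasurable hf.1)
    (Eventually.of_forall fun x => by simpa using abs_coord_le_norm (f x) i)

theorem HasD12Gradient.coord {U : E3 → E3} {G : Fin 3 → E3 → E3} (h : HasD12Gradient U G)
    (i : Fin 3) : HasD12Gradient (fun x => U x i) fun j x => G j x i := by
  obtain ⟨hU, hG, φ, hφ, hφU, hφG⟩ := h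
  refine ⟨memLp_coord hU i, fun j => memLp_coord (hG j) i, fun n x => φ n x i, fun n => ⟨?_, ?_⟩,
    ?_, fun j => ?_⟩
  · exact (contDiff_coord i).comp (hφ n).1
  · exact (hφ n).2.comp_left (g := fun y : E3 => y i) rfl
  · refine tendsto_of_tendsto_of_tendsto_of_le_of_le tendsto_const_nhds hφU (fun _ => zero_le) ?_
    exact fun n => eLpNorm_mono_ae (Eventually.of_forall fun x => abs_coord_le_norm (φ n x - U x) i)
  · refine tendsto_of_tendsto_of_tendsto_of_le_of_le tendsto_const_nhds (hφG j) (fun _ => zero_le) ?_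
    refine fun n => eLpNorm_mono_ae (Eventually.of_forall fun x => ?_)
    rw [partialDeriv_apply ((hφ n).1.differentiable (by simp) x)]
    exact abs_coord_le_norm (partialDeriv (φ n) j x - G j x) i

/-- The gradient in the sense of `D^{1,2}` is a weak gradient. -/
theorem HasD12Gradient.integral_mul {u : E3 → ℝ} {G : Fin 3 → E3 → ℝ} (h : HasD12Gradient u G)
    {η : E3 → ℝ} (hη : ContDiff ℝ ∞ η) (hηc : HasCompactSupport η) (j : Fin 3) :
    ∫ x, η x * G j x = -∫ x, partialDeriv η j x * u x := by
  obtain ⟨hu, hG, φ, hφ, hφu, hφG⟩ := h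
  have hη' := contDiff_partialDeriv hη j
  have hηc' := hasCompactSupport_partialDeriv hηc j
  have h1 : Tendsto (fun n => ∫ x, η x * partialDeriv (φ n) j x) atTop (𝓝 (∫ x, η x * G j x)) := by
    refine tendsto_integral_mul (p := 2) (q := 2) (fn := fun _ => η)
      (hη.continuous.memLp_of_hasCompactSupport hηc)
      (hG j) (fun _ => hη.continuous.memLp_of_hasCompactSupport hηc) (fun n => ?_) ?_ (hφG j)
    · exact (contDiff_partialDeriv (hφ n).1 j).continuous.memLp_of_hasCompactSupport
        (hasCompactSupport_partialDeriv (hφ n).2 j)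
    · simp
  have h2 : Tendsto (fun n => ∫ x, partialDeriv η j x * φ n x) atTop
      (𝓝 (∫ x, partialDeriv η j x * u x)) := by
    refine tendsto_integral_mul (p := 6 / 5) (q := 6) (fn := fun _ => partialDeriv η j)
      (hη'.continuous.memLp_of_hasCompactSupport hηc') hu
      (fun _ => hη'.continuous.memLp_of_hasCompactSupport hηc') (fun n => ?_) ?_ hφu
    · exact (hφ n).1.continuous.memLp_of_hasCompactSupport (hφ n).2
    · simp
  refine tendsto_nhds_unique h1 (h2.neg.congr fun n => ?_)
  exact (integral_mul_partialDeriv hη (hφ n).1 (hφ n).2 j).symm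

theorem hasD12Gradient_of_approx {F : Type*} [NormedAddCommGroup F] [NormedSpace ℝ F]
    {u : E3 → F} {G : Fin 3 → E3 → F} (hu : MemLp u 6 volume) (hG : ∀ j, MemLp (G j) 2 volume)
    (h : ∀ ε : ℝ≥0∞, 0 < ε → ∃ φ : E3 → F, ContDiff ℝ ∞ φ ∧ HasCompactSupport φ ∧
      eLpNorm (fun x => φ x - u x) 6 volume ≤ ε ∧
      ∀ j, eLpNorm (fun x => partialDeriv φ j x - G j x) 2 volume ≤ ε) :
    HasD12Gradient u G := by
  choose φ h1 h2 h3 h4 using fun n : ℕ => h (n : ℝ≥0∞)⁻¹ (by simp)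
  refine ⟨hu, hG, φ, fun n => ⟨h1 n, h2 n⟩, ?_, fun j => ?_⟩
  · exact tendsto_of_tendsto_of_tendsto_of_le_of_le tendsto_const_nhds
      ENNReal.tendsto_inv_nat_nhds_zero (fun _ => zero_le) h3
  · exact tendsto_of_tendsto_of_tendsto_of_le_of_le tendsto_const_nhds
      ENNReal.tendsto_inv_nat_nhds_zero (fun _ => zero_le) fun n => h4 n j

/-! ### Rotations about the axis -/

/-- The rotation by the angle `t` about the `x₃`-axis. -/
def rotation (t : ℝ) : E3 ≃ₗᵢ[ℝ] E3 :=
  LinearIsometry.toLinearIsometryEquiv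
    { toFun := fun x => !₂[Real.cos t * x 0 - Real.sin t * x 1,
        Real.sin t * x 0 + Real.cos t * x 1, x 2]
      map_add' := fun x y => by
        ext i; fin_cases i <;> simp <;> ring
      map_smul' := fun c x => by
        ext i; fin_cases i <;> simp <;> ring
      norm_map' := fun x => by
        refine (sq_eq_sq₀ (norm_nonneg _) (norm_nonneg _)).1 ?_
        rw [norm_sq_eq_sum, norm_sq_eq_sum]
        simp
        linear_combination (x 0 ^ 2 + x 1 ^ 2) * Real.sin_sq_add_cos_sq t } rfl

theorem rotation_apply (t : ℝ) (x : E3) : rotation t x =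
    !₂[Real.cos t * x 0 - Real.sin t * x 1, Real.sin t * x 0 + Real.cos t * x 1, x 2] := rfl

theorem axisDist_eq_of_isometry (g : E3 ≃ₗᵢ[ℝ] E3) (hg : ∀ x, g x 2 = x 2) (x : E3) :
    axisDist (g x) = axisDist x := by
  have h := norm_sq_eq_sum (g x)
  rw [g.norm_map, norm_sq_eq_sum, hg] at h
  unfold axisDist
  congr 1
  linarith

theorem axisDist_rotation (t : ℝ) (x : E3) : axisDist (rotation t x) = axisDist x :=
  axisDist_eq_of_isometry _ (fun _ => rfl) x

/-- The angular derivative `x₁ ∂₂ - x₂ ∂₁`. -/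
def angularDeriv (f : E3 → ℝ) (x : E3) : ℝ := x 0 * partialDeriv f 1 x - x 1 * partialDeriv f 0 x

theorem contDiff_angularDeriv {f : E3 → ℝ} (hf : ContDiff ℝ ∞ f) :
    ContDiff ℝ ∞ (angularDeriv f) :=
  ((contDiff_coord 0).mul (contDiff_partialDeriv hf 1)).sub
    ((contDiff_coord 1).mul (contDiff_partialDeriv hf 0))

theorem angularDeriv_mul {f g : E3 → ℝ} {x : E3} (hf : DifferentiableAt ℝ f x)
    (hg : DifferentiableAt ℝ g x) :
    angularDeriv (fun y => f y * g y) x = f x * angularDeriv g x + angularDeriv f x * g x := by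
  simp only [angularDeriv, partialDeriv_mul hf hg]; ring

theorem partialDeriv_eq_zero_of_notMem_tsupport {F : Type*} [NormedAddCommGroup F]
    [NormedSpace ℝ F] {f : E3 → F} {x : E3} (hx : x ∉ tsupport f) (j : Fin 3) :
    partialDeriv f j x = 0 := by
  have : fderiv ℝ f x = 0 := image_eq_zero_of_notMem_tsupport
    fun h => hx (tsupport_fderiv_subset ℝ h)
  simp [partialDeriv, this]

theorem angularDeriv_eq_zero_of_notMem_tsupport {f : E3 → ℝ} {x : E3} (hx : x ∉ tsupport f) :
    angularDeriv f x = 0 := by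
  simp [angularDeriv, partialDeriv_eq_zero_of_notMem_tsupport hx]

theorem hasCompactSupport_angularDeriv {f : E3 → ℝ} (hf : HasCompactSupport f) :
    HasCompactSupport (angularDeriv f) :=
  HasCompactSupport.of_support_subset_isCompact hf fun x hx => by
    by_contra h
    exact hx (angularDeriv_eq_zero_of_notMem_tsupport h)

theorem fderiv_apply_eq_sum (L : E3 →L[ℝ] ℝ) (v : E3) :
    L v = ∑ j, v j * L (EuclideanSpace.single j 1) := by
  conv_lhs => rw [← (EuclideanSpace.basisFun (Fin 3) ℝ).sum_repr v]
  simp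

theorem hasDerivAt_comp_rotation {f : E3 → ℝ} (hf : ContDiff ℝ ∞ f) (x : E3) (t : ℝ) :
    HasDerivAt (fun s => f (rotation s x)) (angularDeriv f (rotation t x)) t := by
  have h0 : HasDerivAt (fun s => rotation s x)
      (!₂[-(rotation t x 1), rotation t x 0, 0] : E3) t := by
    have h := (((Real.hasDerivAt_cos t).smul_const (!₂[x 0, x 1, 0] : E3)).add
      ((Real.hasDerivAt_sin t).smul_const (!₂[-(x 1), x 0, 0] : E3))).add_const
        (!₂[0, 0, x 2] : E3)
    refine (h.congr_of_eventuallyEq (Eventually.of_forall fun s => ?_)).congr_deriv ?_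
    · rw [rotation_apply]; ext i; fin_cases i <;> simp <;> ring
    · ext i; fin_cases i <;> simp [rotation_apply] <;> ring
  have h := (hf.differentiable (by simp) (rotation t x)).hasFDerivAt.comp_hasDerivAt t h0
  refine h.congr_deriv ?_
  rw [fderiv_apply_eq_sum, Fin.sum_univ_three]
  simp [angularDeriv, partialDeriv]
  ring

theorem isOpen_offAxis : IsOpen {x : E3 | 0 < axisDist x} :=
  isOpen_lt continuous_const continuous_axisDist

/-- A rotation invariant function is weakly constant in the angular direction. -/
theorem integral_mul_angularDeriv_eq_zero {w : E3 → ℝ} (hw : IsSOInvariant w)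
    (hloc : LocallyIntegrableOn w {x | 0 < axisDist x}) {f : E3 → ℝ} (hf : ContDiff ℝ ∞ f)
    (hfc : HasCompactSupport f) (hfs : tsupport f ⊆ {x | 0 < axisDist x}) :
    ∫ x, w x * angularDeriv f x = 0 := by
  have hcont := (contDiff_angularDeriv hf).continuous
  obtain ⟨δ, hδ, hδf⟩ : ∃ δ > 0, ∀ x ∈ tsupport f, δ ≤ axisDist x := by
    rcases (tsupport f).eq_empty_or_nonempty with h | h
    · exact ⟨1, one_pos, by simp [h]⟩
    · obtain ⟨x, hx, hmin⟩ := hfc.isCompact.exists_isMinOn h continuous_axisDist.continuousOn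
      exact ⟨axisDist x, hfs hx, hmin⟩
  obtain ⟨R, hR⟩ := hfc.isCompact.isBounded.exists_norm_le
  -- Rotations preserve the norm and the distance to the axis, so this one compact set contains
  -- every rotated copy of the support and allows a domination uniform in the angle.
  let K : Set E3 := Metric.closedBall 0 R ∩ {x | δ ≤ axisDist x}
  have hK : IsCompact K :=
    (isCompact_closedBall 0 R).inter_right (isClosed_le continuous_const continuous_axisDist)
  have hKw : IntegrableOn w K :=
    hloc.integrableOn_compact_subset (fun x hx => hδ.trans_le hx.2) hK
  have hKf (t : ℝ) (x : E3) (hx : x ∉ K) : rotation t x ∉ tsupport f := fun h =>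
    hx ⟨by simpa [(rotation t).norm_map] using hR _ h,
      by simpa [axisDist_rotation] using hδf _ h⟩
  obtain ⟨C, hC⟩ := (hasCompactSupport_angularDeriv hfc).exists_bound_of_continuous hcont
  obtain ⟨C', hC'⟩ := hfc.exists_bound_of_continuous hf.continuous
  have hint {g : E3 → ℝ} (hg : Continuous g) {M : ℝ} (hM : ∀ x, ‖g x‖ ≤ M) (t : ℝ)
      (hgK : ∀ x ∉ K, g (rotation t x) = 0) : Integrable fun x => w x * g (rotation t x) := by
    have h1 : IntegrableOn (fun x => w x * g (rotation t x)) K :=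
      hKw.mul_bdd (c := M) (hg.comp (rotation t).continuous).aestronglyMeasurable
        (Eventually.of_forall fun x => hM _)
    exact (integrableOn_iff_integrable_of_support_subset fun x hx => by
      by_contra h; exact hx (by simp [hgK x h])).1 h1
  have key := hasDerivAt_integral_of_dominated_loc_of_deriv_le (μ := (volume : Measure E3))
    (F := fun (t : ℝ) x => w x * f (rotation t x)) (x₀ := (0 : ℝ)) (s := Set.univ)
    (F' := fun t x => w x * angularDeriv f (rotation t x))
    (bound := K.indicator fun x => ‖w x‖ * C) univ_mem
    (Eventually.of_forall fun t => (hint hf.continuous hC' t fun x hx =>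
      image_eq_zero_of_notMem_tsupport (hKf t x hx)).1)
    (hint hf.continuous hC' 0 fun x hx => image_eq_zero_of_notMem_tsupport (hKf 0 x hx))
    (hint hcont hC 0 fun x hx => angularDeriv_eq_zero_of_notMem_tsupport (hKf 0 x hx)).1
    (Eventually.of_forall fun x t _ => ?_) ?_
    (Eventually.of_forall fun x t _ => (hasDerivAt_comp_rotation hf x t).const_mul (w x))
  -- A rotation of variables and the invariance of `w` make the integral independent of `t`; its
  -- derivative at `t = 0` is the integral in the goal.
  · have hconst : (fun t : ℝ => ∫ x, w x * f (rotation t x)) = fun _ => ∫ x, w x * f x := by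
      funext t
      rw [← (rotation t).measurePreserving.integral_comp
        (rotation t).toHomeomorph.measurableEmbedding fun x => w x * f x]
      exact integral_congr_ae (Eventually.of_forall fun x => by
        simp only [hw (rotation t) (fun _ => rfl) x])
    have h := key.2
    rw [hconst] at h
    have h0 := h.unique (hasDerivAt_const (0 : ℝ) _)
    have hr (x : E3) : rotation 0 x = x := by
      rw [rotation_apply]; ext i; fin_cases i <;> simp
    simpa [hr] using h0
  · by_cases hx : x ∈ K
    · simp only [hx, Set.indicator_of_mem, norm_mul]
      gcongr
      exact hC _
    · simp [hx, angularDeriv_eq_zero_of_notMem_tsupport (hKf t x hx)]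
  · exact IntegrableOn.integrable_indicator (hKw.norm.mul_const C) hK.measurableSet

/-- The axis is a null set, so testing off it loses nothing. This matters because `u/|x'|` is known
to be locally integrable only there. -/
theorem ae_eq_zero_of_integral_mul_eq_zero_offAxis {f : E3 → ℝ} (hf : LocallyIntegrable f)
    (h : ∀ η : E3 → ℝ, ContDiff ℝ ∞ η → HasCompactSupport η →
      tsupport η ⊆ {x | 0 < axisDist x} → ∫ x, η x * f x = 0) : f =ᵐ[volume] 0 := by
  have h1 := isOpen_offAxis.ae_eq_zero_of_integral_contDiff_smul_eq_zero
    (hf.locallyIntegrableOn _) h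
  filter_upwards [h1, ae_axisDist_pos] with x hx hx0 using hx hx0

/-- The weak angular derivative of `w σ`, `w` rotation invariant, is `w` times that of `σ`. -/
theorem HasD12Gradient.angular_ae_eq {u w σ : E3 → ℝ} {G : Fin 3 → E3 → ℝ}
    (h : HasD12Gradient u G) (hw : IsSOInvariant w)
    (hloc : LocallyIntegrableOn w {x | 0 < axisDist x}) (hσ : ContDiff ℝ ∞ σ)
    (hu : u =ᵐ[volume] fun x => w x * σ x)
    (hwσ : LocallyIntegrable fun x => w x * angularDeriv σ x) :
    (fun x => x 0 * G 1 x - x 1 * G 0 x) =ᵐ[volume] fun x => w x * angularDeriv σ x := by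
  have hGl (j : Fin 3) : LocallyIntegrable (G j) := (h.2.1 j).locallyIntegrable (by norm_num)
  have hxG (i j : Fin 3) : LocallyIntegrable fun x => x i * G j x :=
    (hGl j).continuous_mul (continuous_coord i)
  suffices hs : (fun x => (x 0 * G 1 x - x 1 * G 0 x) - w x * angularDeriv σ x) =ᵐ[volume] 0 by
    filter_upwards [hs] with x hx using sub_eq_zero.1 hx
  refine ae_eq_zero_of_integral_mul_eq_zero_offAxis (((hxG 0 1).sub (hxG 1 0)).sub hwσ) ?_
  intro η hη hηc hηs
  have hdη (x : E3) : DifferentiableAt ℝ η x := hη.differentiable (by simp) x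
  have hdx (i : Fin 3) (x : E3) : DifferentiableAt ℝ (fun y : E3 => y i) x :=
    (contDiff_coord i).differentiable (by simp) x
  -- The coefficients of the angular derivative are absorbed into the test functions. No extra term
  -- arises, since each coordinate is differentiated in the direction of the other one.
  have e1 := h.integral_mul (hη.mul (contDiff_coord 0)) hηc.mul_right 1
  have e2 := h.integral_mul (hη.mul (contDiff_coord 1)) hηc.mul_right 0
  have e3 := integral_mul_angularDeriv_eq_zero hw hloc (hη.mul hσ) hηc.mul_right
    ((tsupport_mul_subset_left (f := η) (g := σ)).trans hηs)
  have i1 : Integrable fun x => η x * (x 0 * G 1 x) :=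
    (hxG 0 1).integrable_smul_left_of_hasCompactSupport hη.continuous hηc
  have i2 : Integrable fun x => η x * (x 1 * G 0 x) :=
    (hxG 1 0).integrable_smul_left_of_hasCompactSupport hη.continuous hηc
  have i3 : Integrable fun x => η x * (w x * angularDeriv σ x) :=
    hwσ.integrable_smul_left_of_hasCompactSupport hη.continuous hηc
  have hul : LocallyIntegrable u := h.1.locallyIntegrable (by norm_num)
  have i4 (i j : Fin 3) : Integrable fun x => partialDeriv (fun y => η y * y i) j x * u x :=
    hul.integrable_smul_left_of_hasCompactSupport
      (contDiff_partialDeriv (hη.mul (contDiff_coord i)) j).continuous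
      (hasCompactSupport_partialDeriv hηc.mul_right j)
  have hsplit : ∫ x, η x * ((x 0 * G 1 x - x 1 * G 0 x) - w x * angularDeriv σ x) =
      (∫ x, η x * (x 0 * G 1 x)) - (∫ x, η x * (x 1 * G 0 x)) -
        ∫ x, η x * (w x * angularDeriv σ x) := by
    have i12 : Integrable fun x => η x * (x 0 * G 1 x) - η x * (x 1 * G 0 x) := i1.sub i2
    rw [← integral_sub i1 i2, ← integral_sub i12 i3]
    congr 1; funext x; ring
  have hE : ∫ x, w x * angularDeriv (fun y => η y * σ y) x =
      ((∫ x, partialDeriv (fun y => η y * y 0) 1 x * u x) -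
        ∫ x, partialDeriv (fun y => η y * y 1) 0 x * u x) +
        ∫ x, η x * (w x * angularDeriv σ x) := by
    have i44 : Integrable fun x => partialDeriv (fun y => η y * y 0) 1 x * u x -
      partialDeriv (fun y => η y * y 1) 0 x * u x := (i4 0 1).sub (i4 1 0)
    rw [← integral_sub (i4 0 1) (i4 1 0), ← integral_add i44 i3]
    refine integral_congr_ae ?_
    filter_upwards [hu] with x hx
    rw [angularDeriv_mul (hdη x) (hσ.differentiable (by simp) x),
      partialDeriv_mul (hdη x) (hdx 0 x), partialDeriv_mul (hdη x) (hdx 1 x), partialDeriv_coord,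
      partialDeriv_coord, hx, angularDeriv, angularDeriv]
    simp
    ring
  rw [hsplit]
  simp only [mul_assoc] at e1 e2
  rw [e1, e2]
  linarith

/-! ### The curl and the gradient in `L²` -/

theorem partialDeriv_comm {g : E3 → ℝ} (hg : ContDiff ℝ ∞ g) (i j : Fin 3) (x : E3) :
    partialDeriv (partialDeriv g j) i x = partialDeriv (partialDeriv g i) j x := by
  have hd : DifferentiableAt ℝ (fderiv ℝ g) x :=
    (hg.fderiv_right (m := ∞) (by simp)).differentiable (by simp) x
  have h (a b : Fin 3) : partialDeriv (partialDeriv g a) b x =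
      fderiv ℝ (fderiv ℝ g) x (EuclideanSpace.single b 1) (EuclideanSpace.single a 1) := by
    change fderiv ℝ (fun y => fderiv ℝ g y (EuclideanSpace.single a 1)) x _ = _
    rw [fderiv_clm_apply hd (differentiableAt_const _)]
    simp
  rw [h, h]
  exact (hg.contDiffAt.isSymmSndFDerivAt (by
    rw [minSmoothness_of_isRCLikeNormedField]
    exact WithTop.coe_le_coe.2 le_top)) _ _

/-- Integration by parts moves the derivative off `f`; both sides become the same integral of `f`
against a mixed second derivative of `g`. -/
theorem integral_partialDeriv_mul_comm {f g : E3 → ℝ} (hf : ContDiff ℝ ∞ f)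
    (hg : ContDiff ℝ ∞ g) (hfc : HasCompactSupport f) (i j : Fin 3) :
    ∫ x, partialDeriv f i x * partialDeriv g j x = ∫ x, partialDeriv f j x * partialDeriv g i x := by
  have h (a b : Fin 3) : ∫ x, partialDeriv g b x * partialDeriv f a x =
      -∫ x, partialDeriv (partialDeriv g b) a x * f x :=
    integral_mul_partialDeriv (contDiff_partialDeriv hg b) hf hfc a
  have h1 := h i j
  have h2 := h j i
  simp only [partialDeriv_comm hg i j] at h1
  rw [← h2] at h1
  simpa only [mul_comm] using h1

theorem HasD12Gradient.integral_mul_comm {f g : E3 → ℝ} {F H : Fin 3 → E3 → ℝ}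
    (hf : HasD12Gradient f F) (hg : HasD12Gradient g H) (i j : Fin 3) :
    ∫ x, F i x * H j x = ∫ x, F j x * H i x := by
  obtain ⟨-, hF, φ, hφ, -, hφF⟩ := hf
  obtain ⟨-, hH, ψ, hψ, -, hψH⟩ := hg
  have hmem {χ : ℕ → E3 → ℝ} (hχ : ∀ n, ContDiff ℝ ∞ (χ n) ∧ HasCompactSupport (χ n)) (a : Fin 3)
      (n : ℕ) : MemLp (partialDeriv (χ n) a) 2 volume :=
    (contDiff_partialDeriv (hχ n).1 a).continuous.memLp_of_hasCompactSupport
      (hasCompactSupport_partialDeriv (hχ n).2 a)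
  have h (a b : Fin 3) := tendsto_integral_mul (hF a) (hH b) (hmem hφ a) (hmem hψ b)
    (hφF a) (hψH b)
  exact tendsto_nhds_unique (h i j) ((h j i).congr fun n =>
    (integral_partialDeriv_mul_comm (hφ n).1 (hψ n).1 (hφ n).2 i j).symm)

theorem memLp_curl {G : Fin 3 → E3 → E3} (hG : ∀ j, MemLp (G j) 2 volume) (i : Fin 3) :
    MemLp (fun x => curl G x i) 2 volume := by
  have h (a b : Fin 3) := memLp_coord (hG a) b
  fin_cases i
  · exact (h 1 2).sub (h 2 1)
  · exact (h 2 0).sub (h 0 2)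
  · exact (h 0 1).sub (h 1 0)

/-- The integrands differ by a combination of the null Lagrangians `∂_i U_j ∂_j U_i - ∂_i U_i ∂_j
U_j`, whose integrals vanish by `HasD12Gradient.integral_mul_comm`. -/
theorem HasD12Gradient.integral_norm_curl_sq {U : E3 → E3} {G : Fin 3 → E3 → E3}
    (h : HasD12Gradient U G) :
    ∫ x, ∑ j, ‖G j x‖ ^ 2 =
      (∫ x, inner ℝ (curl G x) (curl G x)) + ∫ x, (G 0 x 0 + G 1 x 1 + G 2 x 2) ^ 2 := by
  have hm (a b : Fin 3) := memLp_coord (h.2.1 a) b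
  have hp (a b c d : Fin 3) : Integrable fun x => G a x b * G c x d :=
    memLp_one_iff_integrable.1 ((hm c d).smul (r := 1) (hm a b))
  have hsum : Integrable fun x => ∑ j, ‖G j x‖ ^ 2 :=
    integrable_finsetSum _ fun j _ => (h.2.1 j).integrable_norm_pow (by simp)
  have hcurl : Integrable fun x => inner ℝ (curl G x) (curl G x) := by
    have hc (i : Fin 3) : Integrable fun x => curl G x i * curl G x i :=
      memLp_one_iff_integrable.1 ((memLp_curl h.2.1 i).smul (r := 1) (memLp_curl h.2.1 i))
    simp only [inner_eq_sum]
    exact ((hc 0).add (hc 1)).add (hc 2)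
  have hdiv : Integrable fun x => (G 0 x 0 + G 1 x 1 + G 2 x 2) ^ 2 :=
    (((hm 0 0).add (hm 1 1)).add (hm 2 2)).integrable_sq
  have hzero (i j : Fin 3) : ∫ x, (G i x j * G j x i - G j x j * G i x i) = 0 := by
    rw [integral_sub (hp i j j i) (hp j j i i), (h.coord j).integral_mul_comm (h.coord i) i j,
      sub_self]
  have hI (i j : Fin 3) : Integrable fun x => G i x j * G j x i - G j x j * G i x i :=
    (hp i j j i).sub (hp j j i i)
  have hcd : Integrable fun x => inner ℝ (curl G x) (curl G x) +
    (G 0 x 0 + G 1 x 1 + G 2 x 2) ^ 2 := hcurl.add hdiv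
  rw [← integral_add hcurl hdiv, ← sub_eq_zero, ← integral_sub hsum hcd]
  calc _ = ∫ x, (2 * (G 0 x 1 * G 1 x 0 - G 1 x 1 * G 0 x 0) +
        2 * (G 0 x 2 * G 2 x 0 - G 2 x 2 * G 0 x 0) +
        2 * (G 1 x 2 * G 2 x 1 - G 2 x 2 * G 1 x 1)) := by
        congr 1; funext x
        simp only [Fin.sum_univ_three, norm_sq_eq_sum, inner_eq_sum, curl]
        simp
        ring
    _ = 0 := by
        have h1 : Integrable fun x => 2 * (G 0 x 1 * G 1 x 0 - G 1 x 1 * G 0 x 0) +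
            2 * (G 0 x 2 * G 2 x 0 - G 2 x 2 * G 0 x 0) :=
          ((hI 0 1).const_mul 2).add ((hI 0 2).const_mul 2)
        rw [integral_add h1 ((hI 1 2).const_mul 2),
          integral_add ((hI 0 1).const_mul 2) ((hI 0 2).const_mul 2), integral_const_mul,
          integral_const_mul, integral_const_mul, hzero, hzero, hzero]
        simp

/-! ### Toroidal fields -/

theorem IsSOInvariant.div_axisDist {u : E3 → ℝ} (hu : IsSOInvariant u) :
    IsSOInvariant fun x => u x / axisDist x := fun g hg x => by
  simp only [hu g hg x, axisDist_eq_of_isometry g hg x]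

theorem toroidal_apply {u : E3 → ℝ} {U : E3 → E3}
    (hU : U =ᵐ[volume] fun x => (u x / axisDist x) • (!₂[-(x 1), x 0, 0] : E3)) :
    ∀ᵐ x, U x 0 = u x / axisDist x * -(x 1) ∧ U x 1 = u x / axisDist x * x 0 ∧ U x 2 = 0 := by
  filter_upwards [hU] with x hx
  simp [hx]

/-- The quotient is recovered as `(x₁ U₂ - x₂ U₁)/|x'|²`, and the factor `|x'|⁻²` is continuous off
the axis only. -/
theorem locallyIntegrableOn_of_toroidal {u : E3 → ℝ} {U : E3 → E3} (hL : LocallyIntegrable U)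
    (hU : U =ᵐ[volume] fun x => (u x / axisDist x) • (!₂[-(x 1), x 0, 0] : E3)) :
    LocallyIntegrableOn (fun x => u x / axisDist x) {x | 0 < axisDist x} := by
  have hc (i : Fin 3) : LocallyIntegrable fun x => U x i := fun x => by
    obtain ⟨s, hs, hi⟩ := hL x
    exact ⟨s, hs, (EuclideanSpace.proj (𝕜 := ℝ) i).integrable_comp hi⟩
  have h1 : LocallyIntegrable fun x => x 0 * U x 1 - x 1 * U x 0 :=
    ((hc 1).continuous_mul (continuous_coord 0)).sub ((hc 0).continuous_mul (continuous_coord 1))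
  have h2 : LocallyIntegrableOn (fun x => (axisDist x ^ 2)⁻¹ * (x 0 * U x 1 - x 1 * U x 0))
      {x | 0 < axisDist x} := by
    refine (h1.locallyIntegrableOn _).continuousOn_mul ?_ isOpen_offAxis.isLocallyClosed
    refine ContinuousOn.inv₀ (by fun_prop) fun x (hx : 0 < axisDist x) => by positivity
  intro x hx
  obtain ⟨s, hs, hi⟩ := h2 x hx
  refine ⟨s, hs, hi.congr ?_⟩
  refine ae_restrict_of_ae ?_
  filter_upwards [toroidal_apply hU, ae_axisDist_pos] with y hy hy0
  rw [hy.1, hy.2.1, axisDist_sq]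
  have : y 0 ^ 2 + y 1 ^ 2 ≠ 0 := by rw [← axisDist_sq]; positivity
  field_simp
  ring

section Toroidal

variable {u : E3 → ℝ} {U : E3 → E3} {G : Fin 3 → E3 → E3}

/-- For a test function `η` one has `∇η · U = (u/|x'|) ∂_φ η`, and an invariant function integrates
to zero against an angular derivative. -/
theorem HasD12Gradient.div_eq_zero_of_toroidal (h : HasD12Gradient U G) (hu : IsSOInvariant u)
    (hU : U =ᵐ[volume] fun x => (u x / axisDist x) • (!₂[-(x 1), x 0, 0] : E3)) :
    ∀ᵐ x, G 0 x 0 + G 1 x 1 + G 2 x 2 = 0 := by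
  have hloc := locallyIntegrableOn_of_toroidal (h.1.locallyIntegrable (by norm_num)) hU
  have hGl (i : Fin 3) : LocallyIntegrable fun x => G i x i :=
    (memLp_coord (h.2.1 i) i).locallyIntegrable (by norm_num)
  have hUl (i : Fin 3) : LocallyIntegrable fun x => U x i :=
    (memLp_coord h.1 i).locallyIntegrable (by norm_num)
  refine ae_eq_zero_of_integral_mul_eq_zero_offAxis (((hGl 0).add (hGl 1)).add (hGl 2)) ?_
  intro η hη hηc hηs
  have e (i : Fin 3) := (h.coord i).integral_mul hη hηc i
  have hi (i : Fin 3) : Integrable fun x => η x * G i x i :=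
    (hGl i).integrable_smul_left_of_hasCompactSupport hη.continuous hηc
  have hj (i : Fin 3) : Integrable fun x => partialDeriv η i x * U x i :=
    (hUl i).integrable_smul_left_of_hasCompactSupport (contDiff_partialDeriv hη i).continuous
      (hasCompactSupport_partialDeriv hηc i)
  have e3 := integral_mul_angularDeriv_eq_zero hu.div_axisDist hloc hη hηc hηs
  have h12 : Integrable fun x => η x * G 0 x 0 + η x * G 1 x 1 := (hi 0).add (hi 1)
  have j12 : Integrable fun x => partialDeriv η 0 x * U x 0 + partialDeriv η 1 x * U x 1 :=
    (hj 0).add (hj 1)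
  have hs : ∫ x, (u x / axisDist x) * angularDeriv η x =
      ((∫ x, partialDeriv η 0 x * U x 0) + ∫ x, partialDeriv η 1 x * U x 1) +
        ∫ x, partialDeriv η 2 x * U x 2 := by
    rw [← integral_add (hj 0) (hj 1), ← integral_add j12 (hj 2)]
    refine integral_congr_ae ?_
    filter_upwards [toroidal_apply hU] with x hx
    rw [hx.1, hx.2.1, hx.2.2, angularDeriv]
    ring
  calc ∫ x, η x * (G 0 x 0 + G 1 x 1 + G 2 x 2)
      = ((∫ x, η x * G 0 x 0) + ∫ x, η x * G 1 x 1) + ∫ x, η x * G 2 x 2 := by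
        rw [← integral_add (hi 0) (hi 1), ← integral_add h12 (hi 2)]
        congr 1; funext x; ring
    _ = 0 := by rw [e, e, e]; linarith

/-- This is `∂_φ U = -u e_r`: in `U = (u/|x'|)(-x₂, x₁, 0)` the angular derivative acts only on the
explicit coordinates. -/
theorem HasD12Gradient.angular_of_toroidal (h : HasD12Gradient U G) (hu : IsSOInvariant u)
    (hU : U =ᵐ[volume] fun x => (u x / axisDist x) • (!₂[-(x 1), x 0, 0] : E3)) :
    ∀ᵐ x, x 0 * G 1 x 0 - x 1 * G 0 x 0 = -(u x / axisDist x * x 0) ∧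
      x 0 * G 1 x 1 - x 1 * G 0 x 1 = -(u x / axisDist x * x 1) := by
  have hloc := locallyIntegrableOn_of_toroidal (h.1.locallyIntegrable (by norm_num)) hU
  have hUl (i : Fin 3) : LocallyIntegrable fun x => U x i :=
    (memLp_coord h.1 i).locallyIntegrable (by norm_num)
  have d0 (x : E3) : angularDeriv (fun y => -(y 1)) x = -(x 0) := by
    have e (j : Fin 3) : partialDeriv (fun y : E3 => -(y 1)) j x =
        -partialDeriv (fun y : E3 => y 1) j x := by
      simp [partialDeriv, fderiv_fun_neg]
    simp [angularDeriv, e, partialDeriv_coord]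
  have d1 (x : E3) : angularDeriv (fun y => y 0) x = -(x 1) := by
    simp [angularDeriv, partialDeriv_coord]
  have a0 := (h.coord 0).angular_ae_eq hu.div_axisDist hloc (contDiff_coord 1).neg
    (by filter_upwards [toroidal_apply hU] with x hx using hx.1) (by
      simp only [d0]
      refine (hUl 1).neg.congr ?_
      filter_upwards [toroidal_apply hU] with x hx
      simp [hx.2.1])
  have a1 := (h.coord 1).angular_ae_eq hu.div_axisDist hloc (contDiff_coord 0)
    (by filter_upwards [toroidal_apply hU] with x hx using hx.2.1) (by
      simp only [d1]
      refine (hUl 0).congr ?_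
      filter_upwards [toroidal_apply hU] with x hx
      simp [hx.1])
  filter_upwards [a0, a1] with x h0 h1
  simp only [d0, d1] at h0 h1
  exact ⟨by rw [h0]; ring, by rw [h1]; ring⟩

/-- The gradient of the scalar profile of a toroidal field. -/
def profileGradient (G : Fin 3 → E3 → E3) (j : Fin 3) (x : E3) : ℝ :=
  (x 0 * G j x 1 - x 1 * G j x 0) / axisDist x

/-- In the frame `e_r, e_φ, e₃` the angular components of the `∂_j U` form the profile gradient. The
radial components `p j` satisfy `x₁ p₂ - x₂ p₁ = -u` (coordinates numbered from one), so
Cauchy-Schwarz bounds `u²/|x'|²` by their squares. -/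
theorem HasD12Gradient.energy_density_le (h : HasD12Gradient U G) (hu : IsSOInvariant u)
    (hU : U =ᵐ[volume] fun x => (u x / axisDist x) • (!₂[-(x 1), x 0, 0] : E3)) :
    ∀ᵐ x, (∑ j, profileGradient G j x ^ 2) + u x ^ 2 / axisDist x ^ 2 ≤ ∑ j, ‖G j x‖ ^ 2 := by
  filter_upwards [h.angular_of_toroidal hu hU, ae_axisDist_pos] with x hx hr
  obtain ⟨h0, h1⟩ := hx
  have hr2 := axisDist_sq x
  set r := axisDist x
  let p (j : Fin 3) : ℝ := (x 0 * G j x 0 + x 1 * G j x 1) / r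
  have hpq (j : Fin 3) : p j ^ 2 + profileGradient G j x ^ 2 + G j x 2 ^ 2 = ‖G j x‖ ^ 2 := by
    rw [norm_sq_eq_sum]
    simp only [p, profileGradient]
    change _ + (_ / r) ^ 2 + _ = _
    rw [div_pow, div_pow, hr2]
    have : x 0 ^ 2 + x 1 ^ 2 ≠ 0 := by rw [← hr2]; positivity
    field_simp
    ring
  have hu1 : x 0 * p 1 - x 1 * p 0 = -u x := by
    have : (x 0 * p 1 - x 1 * p 0) * r = x 0 * (x 0 * G 1 x 0 - x 1 * G 0 x 0) +
        x 1 * (x 0 * G 1 x 1 - x 1 * G 0 x 1) := by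
      simp only [p]; field_simp; ring
    rw [h0, h1] at this
    have h2 : (x 0 * p 1 - x 1 * p 0) * r = -u x * r := by
      rw [this]
      have : u x / r * r = u x := div_mul_cancel₀ _ hr.ne'
      linear_combination (u x / r) * hr2 - r * this
    exact mul_right_cancel₀ hr.ne' h2
  have hu2 : u x ^ 2 / r ^ 2 ≤ p 0 ^ 2 + p 1 ^ 2 := by
    have hu3 : u x ^ 2 = (x 0 * p 1 - x 1 * p 0) ^ 2 := by rw [hu1]; ring
    rw [div_le_iff₀ (by positivity), hr2, hu3]
    nlinarith [sq_nonneg (x 0 * p 0 + x 1 * p 1)]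
  simp only [Fin.sum_univ_three, ← hpq]
  nlinarith [sq_nonneg (p 2), sq_nonneg (G 0 x 2), sq_nonneg (G 1 x 2), sq_nonneg (G 2 x 2)]

end Toroidal

/-! ### Cutoff functions away from the axis and infinity -/

theorem deriv_smoothTransition_eq_zero {t : ℝ} (ht : t < 0 ∨ 1 < t) :
    deriv Real.smoothTransition t = 0 := by
  rcases ht with ht | ht
  · have h : Real.smoothTransition =ᶠ[𝓝 t] fun _ => 0 := by
      filter_upwards [Iio_mem_nhds ht] with s hs
      exact Real.smoothTransition.zero_of_nonpos hs.le
    simp [h.deriv_eq]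
  · have h : Real.smoothTransition =ᶠ[𝓝 t] fun _ => 1 := by
      filter_upwards [Ioi_mem_nhds ht] with s hs
      exact Real.smoothTransition.one_of_one_le hs.le
    simp [h.deriv_eq]

theorem exists_bound_deriv_smoothTransition :
    ∃ C, 0 ≤ C ∧ ∀ t, |deriv Real.smoothTransition t| ≤ C := by
  have hc : Continuous (deriv Real.smoothTransition) :=
    (Real.smoothTransition.contDiff (n := 1)).continuous_deriv le_rfl
  obtain ⟨C, hC⟩ := isCompact_Icc.exists_bound_of_continuousOn (s := Set.Icc (0 : ℝ) 1)
    hc.continuousOn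
  have hC0 : 0 ≤ C := (norm_nonneg _).trans (hC 0 (by simp))
  refine ⟨C, hC0, fun t => ?_⟩
  by_cases ht : t ∈ Set.Icc (0 : ℝ) 1
  · exact hC t ht
  · have ht' : t < 0 ∨ 1 < t := by
      by_contra! h
      exact ht ⟨h.1, h.2⟩
    simpa [deriv_smoothTransition_eq_zero ht'] using hC0

theorem partialDeriv_smoothTransition_comp {a : E3 → ℝ} {a' : E3 →L[ℝ] ℝ} {x : E3}
    (ha : HasFDerivAt a a' x) (j : Fin 3) :
    partialDeriv (fun y => Real.smoothTransition (a y)) j x =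
      deriv Real.smoothTransition (a x) * a' (EuclideanSpace.single j 1) := by
  have hd : HasDerivAt Real.smoothTransition (deriv Real.smoothTransition (a x)) (a x) :=
    ((Real.smoothTransition.contDiff (n := 1)).differentiable (by simp) _).hasDerivAt
  have h := hd.comp_hasFDerivAt x ha
  change fderiv ℝ (Real.smoothTransition ∘ a) x _ = _
  simp [h.fderiv]

theorem hasFDerivAt_coord (i : Fin 3) (x : E3) :
    HasFDerivAt (fun y : E3 => y i) (EuclideanSpace.proj (𝕜 := ℝ) i : E3 →L[ℝ] ℝ) x :=
  (EuclideanSpace.proj (𝕜 := ℝ) i).hasFDerivAt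

/-- The cutoff function that vanishes for `N |x'|² ≤ 1` and for `|x|² ≥ 2 N`. -/
def cutoff (N : ℝ) (x : E3) : ℝ :=
  Real.smoothTransition (N * (x 0 ^ 2 + x 1 ^ 2) - 1) *
    Real.smoothTransition (2 - N⁻¹ * (x 0 ^ 2 + x 1 ^ 2 + x 2 ^ 2))

theorem contDiff_cutoff (N : ℝ) : ContDiff ℝ ∞ (cutoff N) := by
  refine ContDiff.mul (Real.smoothTransition.contDiff.comp ?_)
    (Real.smoothTransition.contDiff.comp ?_) <;> fun_prop

theorem cutoff_nonneg (N : ℝ) (x : E3) : 0 ≤ cutoff N x :=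
  mul_nonneg (Real.smoothTransition.nonneg _) (Real.smoothTransition.nonneg _)

theorem cutoff_le_one (N : ℝ) (x : E3) : cutoff N x ≤ 1 :=
  mul_le_one₀ (Real.smoothTransition.le_one _) (Real.smoothTransition.nonneg _)
    (Real.smoothTransition.le_one _)

theorem cutoff_eq_zero_of_axisDist {N : ℝ} {x : E3} (hx : N * axisDist x ^ 2 ≤ 1) :
    cutoff N x = 0 := by
  rw [cutoff, ← axisDist_sq, Real.smoothTransition.zero_of_nonpos (by linarith), zero_mul]

theorem hasCompactSupport_cutoff {N : ℝ} (hN : 0 < N) : HasCompactSupport (cutoff N) := by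
  refine HasCompactSupport.intro (isCompact_closedBall (0 : E3) (Real.sqrt (2 * N))) fun x hx => ?_
  have h : 2 * N < ‖x‖ ^ 2 := by
    rw [← Real.sqrt_lt' (by by_contra h; exact hx (by simp [norm_le_zero_iff.1 (not_lt.1 h)]))]
    simpa using hx
  rw [cutoff, ← norm_sq_eq_sum, Real.smoothTransition.zero_of_nonpos (x := 2 - _), mul_zero]
  have : 2 ≤ N⁻¹ * ‖x‖ ^ 2 := by
    rw [inv_mul_eq_div, le_div_iff₀ hN]; exact h.le
  linarith

theorem hasFDerivAt_cutoff_inner (N : ℝ) (x : E3) :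
    HasFDerivAt (fun y : E3 => N * (y 0 ^ 2 + y 1 ^ 2) - 1)
      (N • ((2 * x 0) • (EuclideanSpace.proj (𝕜 := ℝ) (0 : Fin 3) : E3 →L[ℝ] ℝ) +
        (2 * x 1) • (EuclideanSpace.proj (𝕜 := ℝ) (1 : Fin 3) : E3 →L[ℝ] ℝ))) x := by
  have h (i : Fin 3) := (hasFDerivAt_coord i x).pow 2
  refine ((((h 0).add (h 1)).const_mul N).sub_const 1).congr_fderiv ?_
  ext v; simp

theorem hasFDerivAt_cutoff_outer (N : ℝ) (x : E3) :
    HasFDerivAt (fun y : E3 => 2 - N⁻¹ * (y 0 ^ 2 + y 1 ^ 2 + y 2 ^ 2))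
      (-(N⁻¹ • ((2 * x 0) • (EuclideanSpace.proj (𝕜 := ℝ) (0 : Fin 3) : E3 →L[ℝ] ℝ) +
        (2 * x 1) • (EuclideanSpace.proj (𝕜 := ℝ) (1 : Fin 3) : E3 →L[ℝ] ℝ) +
        (2 * x 2) • (EuclideanSpace.proj (𝕜 := ℝ) (2 : Fin 3) : E3 →L[ℝ] ℝ)))) x := by
  have h (i : Fin 3) := (hasFDerivAt_coord i x).pow 2
  refine (((((h 0).add (h 1)).add (h 2)).const_mul N⁻¹).const_sub 2).congr_fderiv ?_
  ext v; simp

theorem partialDeriv_cutoff (N : ℝ) (j : Fin 3) (x : E3) :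
    ∃ a b : ℝ, |a| ≤ 2 * |N| * axisDist x ∧ |b| ≤ 2 * |N⁻¹| * ‖x‖ ∧ partialDeriv (cutoff N) j x =
      Real.smoothTransition (N * axisDist x ^ 2 - 1) *
          (deriv Real.smoothTransition (2 - N⁻¹ * ‖x‖ ^ 2) * b) +
        deriv Real.smoothTransition (N * axisDist x ^ 2 - 1) * a *
          Real.smoothTransition (2 - N⁻¹ * ‖x‖ ^ 2) := by
  refine ⟨(N • ((2 * x 0) • (EuclideanSpace.proj (𝕜 := ℝ) (0 : Fin 3) : E3 →L[ℝ] ℝ) +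
      (2 * x 1) • (EuclideanSpace.proj (𝕜 := ℝ) (1 : Fin 3) : E3 →L[ℝ] ℝ)))
        (EuclideanSpace.single j 1),
    (-(N⁻¹ • ((2 * x 0) • (EuclideanSpace.proj (𝕜 := ℝ) (0 : Fin 3) : E3 →L[ℝ] ℝ) +
      (2 * x 1) • (EuclideanSpace.proj (𝕜 := ℝ) (1 : Fin 3) : E3 →L[ℝ] ℝ) +
      (2 * x 2) • (EuclideanSpace.proj (𝕜 := ℝ) (2 : Fin 3) : E3 →L[ℝ] ℝ))))
        (EuclideanSpace.single j 1), ?_, ?_, ?_⟩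
  · have h0 := mul_le_mul_of_nonneg_left (abs_coord_zero_le_axisDist x) (abs_nonneg N)
    have h1 := mul_le_mul_of_nonneg_left (abs_coord_one_le_axisDist x) (abs_nonneg N)
    have h2 := mul_nonneg (abs_nonneg N) (axisDist_nonneg x)
    fin_cases j <;> simp [abs_mul] <;> linarith
  · have h (i : Fin 3) := mul_le_mul_of_nonneg_left (abs_coord_le_norm x i) (abs_nonneg N⁻¹)
    have h0 := h 0
    have h1 := h 1
    have h2 := h 2
    simp only [abs_inv] at h0 h1 h2
    fin_cases j <;> simp [abs_mul] <;> linarith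
  · unfold cutoff
    rw [partialDeriv_mul, partialDeriv_smoothTransition_comp (hasFDerivAt_cutoff_inner N x),
      partialDeriv_smoothTransition_comp (hasFDerivAt_cutoff_outer N x), ← norm_sq_eq_sum,
      ← axisDist_sq]
    · exact ((Real.smoothTransition.contDiff (n := 1)).differentiable (by simp) _).comp x
        (hasFDerivAt_cutoff_inner N x).differentiableAt
    · exact ((Real.smoothTransition.contDiff (n := 1)).differentiable (by simp) _).comp x
        (hasFDerivAt_cutoff_outer N x).differentiableAt

/-- The bound is uniform in `N`. The inner factor varies only where `1 ≤ N|x'|² ≤ 2`, with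
derivative at most `2CN|x'|`; the outer one only where `N ≤ |x|² ≤ 2N`, with derivative at most
`2C|x|/N`, and `|x'| ≤ |x|`. Each contributes `4C`. -/
theorem exists_bound_partialDeriv_cutoff :
    ∃ C, 0 ≤ C ∧ ∀ N > 0, ∀ j x, axisDist x * |partialDeriv (cutoff N) j x| ≤ C := by
  obtain ⟨C, hC, hT⟩ := exists_bound_deriv_smoothTransition
  refine ⟨8 * C, by positivity, fun N hN j x => ?_⟩
  obtain ⟨a, b, ha, hb, hab⟩ := partialDeriv_cutoff N j x
  rw [abs_of_pos hN] at ha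
  rw [abs_of_pos (inv_pos.2 hN)] at hb
  have hr := axisDist_nonneg x
  have hr' := axisDist_le_norm x
  have key1 : axisDist x * (|deriv Real.smoothTransition (N * axisDist x ^ 2 - 1)| * |a|) ≤
      4 * C := by
    by_cases h : N * axisDist x ^ 2 - 1 ≤ 1
    · calc _ ≤ axisDist x * (C * (2 * N * axisDist x)) := by gcongr; exact hT _
        _ = 2 * C * (N * axisDist x ^ 2) := by ring
        _ ≤ 2 * C * 2 := by gcongr; linarith
        _ = 4 * C := by ring
    · rw [deriv_smoothTransition_eq_zero (Or.inr (not_le.1 h))]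
      simpa using hC
  have key2 : axisDist x * (|deriv Real.smoothTransition (2 - N⁻¹ * ‖x‖ ^ 2)| * |b|) ≤ 4 * C := by
    by_cases h : 0 ≤ 2 - N⁻¹ * ‖x‖ ^ 2
    · calc _ ≤ ‖x‖ * (C * (2 * N⁻¹ * ‖x‖)) := by gcongr; exact hT _
        _ = 2 * C * (N⁻¹ * ‖x‖ ^ 2) := by ring
        _ ≤ 2 * C * 2 := by gcongr; linarith
        _ = 4 * C := by ring
    · rw [deriv_smoothTransition_eq_zero (Or.inl (not_le.1 h))]
      simpa using hC
  have hT1 (t : ℝ) : |Real.smoothTransition t| ≤ 1 := by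
    rw [abs_of_nonneg (Real.smoothTransition.nonneg t)]; exact Real.smoothTransition.le_one t
  calc axisDist x * |partialDeriv (cutoff N) j x|
      ≤ axisDist x * (1 * (|deriv Real.smoothTransition (2 - N⁻¹ * ‖x‖ ^ 2)| * |b|) +
        |deriv Real.smoothTransition (N * axisDist x ^ 2 - 1)| * |a| * 1) := by
        rw [hab]
        gcongr
        refine (abs_add_le _ _).trans ?_
        simp only [abs_mul]
        gcongr
        · exact hT1 _
        · exact hT1 _
    _ ≤ 8 * C := by linarith

theorem eventually_cutoff_eq_one {x : E3} (hx : 0 < axisDist x) :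
    ∀ᶠ N : ℝ in atTop, cutoff N x = 1 ∧ ∀ j, partialDeriv (cutoff N) j x = 0 := by
  filter_upwards [eventually_gt_atTop (2 / axisDist x ^ 2), eventually_gt_atTop (‖x‖ ^ 2),
    eventually_gt_atTop 0] with N h1 h2 h3
  have h1' : 1 < N * axisDist x ^ 2 - 1 := by
    rw [div_lt_iff₀ (by positivity)] at h1; linarith
  have h2' : 1 < 2 - N⁻¹ * ‖x‖ ^ 2 := by
    have : N⁻¹ * ‖x‖ ^ 2 < 1 := by rw [inv_mul_lt_one₀ h3]; exact h2
    linarith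
  constructor
  · rw [cutoff, ← norm_sq_eq_sum, ← axisDist_sq, Real.smoothTransition.one_of_one_le h1'.le,
      Real.smoothTransition.one_of_one_le h2'.le, one_mul]
  · intro j
    obtain ⟨a, b, -, -, hab⟩ := partialDeriv_cutoff N j x
    rw [hab, deriv_smoothTransition_eq_zero (Or.inr h1'),
      deriv_smoothTransition_eq_zero (Or.inr h2')]
    simp

/-- Approximation in `D^{1,2}` by test functions that vanish near the axis. -/
theorem HasD12Gradient.exists_approx_offAxis {F : Type*} [NormedAddCommGroup F] [NormedSpace ℝ F]
    {U : E3 → F} {G : Fin 3 → E3 → F} (h : HasD12Gradient U G)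
    (hr : MemLp (fun x => (axisDist x)⁻¹ • U x) 2 volume) {ε : ℝ≥0∞} (hε : 0 < ε) :
    ∃ Φ : E3 → F, ContDiff ℝ ∞ Φ ∧ HasCompactSupport Φ ∧
      (∃ δ > 0, ∀ x, axisDist x < δ → Φ x = 0) ∧
      eLpNorm (fun x => Φ x - U x) 6 volume ≤ ε ∧
      (∀ j, eLpNorm (fun x => partialDeriv Φ j x - G j x) 2 volume ≤ ε) ∧
      eLpNorm (fun x => (axisDist x)⁻¹ • (Φ x - U x)) 2 volume ≤ ε := by
  obtain ⟨hU, hG, φ, hφ, hφU, hφG⟩ := h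
  obtain ⟨C, hC0, hC⟩ := exists_bound_partialDeriv_cutoff
  have hε2 : 0 < ε / 2 := ENNReal.half_pos hε.ne'
  let η (k : ℕ) : E3 → ℝ := cutoff (k + 1)
  have hNpos (k : ℕ) : (0 : ℝ) < k + 1 := by positivity
  have hη (k : ℕ) : ContDiff ℝ ∞ (η k) := contDiff_cutoff _
  have hηc (k : ℕ) : HasCompactSupport (η k) := hasCompactSupport_cutoff (hNpos k)
  have hη1 (k : ℕ) (x : E3) : |η k x| ≤ 1 := by
    rw [abs_of_nonneg (cutoff_nonneg _ _)]; exact cutoff_le_one _ _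
  have hη1' (k : ℕ) (x : E3) : |η k x - 1| ≤ 1 := by
    rw [abs_le]; constructor <;> linarith [cutoff_nonneg (k + 1) x, cutoff_le_one (k + 1) x]
  have hηd (k : ℕ) (j : Fin 3) : Continuous (partialDeriv (η k) j) :=
    (contDiff_partialDeriv (hη k) j).continuous
  have hev (x : E3) (hx : 0 < axisDist x) :
      ∀ᶠ k : ℕ in atTop, η k x = 1 ∧ ∀ j, partialDeriv (η k) j x = 0 :=
    (tendsto_natCast_atTop_atTop.atTop_add tendsto_const_nhds).eventually
      (eventually_cutoff_eq_one hx)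
  have hrm : AEStronglyMeasurable (fun x => (axisDist x)⁻¹) (volume : Measure E3) :=
    continuous_axisDist.measurable.inv.aestronglyMeasurable
  have t1 : Tendsto (fun k => eLpNorm (fun x => (η k x - 1) • U x) 6 volume) atTop (𝓝 0) := by
    refine tendsto_eLpNorm_zero_of_dominated (by simp) (by simp)
      (fun k => ((hη k).continuous.sub continuous_const).aestronglyMeasurable.smul hU.1) hU.norm
      (fun k => Eventually.of_forall fun x => ?_) ?_
    · rw [norm_smul]
      exact mul_le_of_le_one_left (norm_nonneg _) (hη1' k x)
    · filter_upwards [ae_axisDist_pos] with x hx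
      filter_upwards [hev x hx] with k hk
      simp [hk.1]
  -- The term `∂_j η U` is dominated by `C |U|/|x'|`, which is square integrable by `hr`.
  have t2 (j : Fin 3) : Tendsto (fun k => eLpNorm (fun x => (η k x - 1) • G j x +
      partialDeriv (η k) j x • U x) 2 volume) atTop (𝓝 0) := by
    refine tendsto_eLpNorm_zero_of_dominated (by simp) (by simp)
      (fun k => (((hη k).continuous.sub continuous_const).aestronglyMeasurable.smul (hG j).1).add
        ((hηd k j).aestronglyMeasurable.smul hU.1)) ((hG j).norm.add (hr.norm.const_mul C))
      (fun k => ?_) ?_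
    · filter_upwards [ae_axisDist_pos] with x hx
      refine (norm_add_le _ _).trans (add_le_add ?_ ?_)
      · rw [norm_smul]
        exact mul_le_of_le_one_left (norm_nonneg _) (hη1' k x)
      · change _ ≤ C * ‖(axisDist x)⁻¹ • U x‖
        rw [norm_smul, norm_smul, ← mul_assoc, norm_inv, Real.norm_of_nonneg hx.le]
        gcongr
        rw [← div_eq_mul_inv, le_div_iff₀ hx, mul_comm]
        exact hC _ (hNpos k) j x
    · filter_upwards [ae_axisDist_pos] with x hx
      filter_upwards [hev x hx] with k hk
      simp [hk.1, hk.2]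
  have t3 : Tendsto (fun k => eLpNorm (fun x => (η k x - 1) • (axisDist x)⁻¹ • U x) 2 volume)
      atTop (𝓝 0) := by
    refine tendsto_eLpNorm_zero_of_dominated (by simp) (by simp)
      (fun k => ((hη k).continuous.sub continuous_const).aestronglyMeasurable.smul hr.1) hr.norm
      (fun k => Eventually.of_forall fun x => ?_) ?_
    · rw [norm_smul]
      exact mul_le_of_le_one_left (norm_nonneg _) (hη1' k x)
    · filter_upwards [ae_axisDist_pos] with x hx
      filter_upwards [hev x hx] with k hk
      simp [hk.1]
  -- The cutoff is fixed before `n`: the estimates for `η k • (φ n - U)` use the size of `∂ (η k)`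
  -- and the distance of its support from the axis, both dependent on `k`. Each stage costs `ε / 2`.
  obtain ⟨k, hk1, hk2, hk3⟩ := ((t1.eventually_lt_const hε2).and
    ((eventually_all.2 fun j => (t2 j).eventually_lt_const hε2).and
      (t3.eventually_lt_const hε2))).exists
  have hφm (n : ℕ) : AEStronglyMeasurable (fun x => φ n x - U x) volume :=
    (hφ n).1.continuous.aestronglyMeasurable.sub hU.1
  have hφm' (n : ℕ) (j : Fin 3) :
      AEStronglyMeasurable (fun x => partialDeriv (φ n) j x - G j x) volume :=
    (contDiff_partialDeriv (hφ n).1 j).continuous.aestronglyMeasurable.sub (hG j).1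
  have mul3 {a : E3 → ℝ} (ha : MemLp a 3 volume) :
      Tendsto (fun n => eLpNorm (fun x => a x • (φ n x - U x)) 2 volume) atTop (𝓝 0) := by
    have := ENNReal.Tendsto.const_mul hφU (Or.inr ha.2.ne)
    rw [mul_zero] at this
    exact tendsto_of_tendsto_of_tendsto_of_le_of_le tendsto_const_nhds this (fun _ => zero_le)
      fun n => eLpNorm_smul_le_mul_eLpNorm (p := 3) (q := 6) (r := 2) (hφm n) ha.1
  have hle {p : ℝ≥0∞} (f : E3 → F) : eLpNorm (fun x => η k x • f x) p volume ≤
      eLpNorm f p volume :=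
    eLpNorm_mono_ae (Eventually.of_forall fun x => by
      rw [norm_smul]; exact mul_le_of_le_one_left (norm_nonneg _) (hη1 k x))
  obtain ⟨δ, hδ, hδη⟩ : ∃ δ > 0, ∀ x, axisDist x < δ → η k x = 0 := by
    -- The cutoff vanishes for `|x'|² ≤ 1/(k+1)`; the radius `1/(k+1) ≤ 1` is smaller than needed
    -- and avoids a square root.
    refine ⟨((k : ℝ) + 1)⁻¹, by positivity, fun x hx => cutoff_eq_zero_of_axisDist ?_⟩
    have hr := axisDist_nonneg x
    have h1 : ((k : ℝ) + 1) * axisDist x ≤ 1 := by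
      have := mul_le_mul_of_nonneg_left hx.le (hNpos k).le
      rwa [mul_inv_cancel₀ (hNpos k).ne'] at this
    have h2 : axisDist x ≤ 1 := by nlinarith [Nat.cast_nonneg (α := ℝ) k]
    nlinarith
  have s1 : Tendsto (fun n => eLpNorm (fun x => η k x • (φ n x - U x)) 6 volume) atTop (𝓝 0) :=
    tendsto_of_tendsto_of_tendsto_of_le_of_le tendsto_const_nhds hφU (fun _ => zero_le)
      fun n => hle _
  have s2 (j : Fin 3) : Tendsto (fun n => eLpNorm (fun x => η k x • (partialDeriv (φ n) j x - G j x)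
      + partialDeriv (η k) j x • (φ n x - U x)) 2 volume) atTop (𝓝 0) := by
    have := (hφG j).add (mul3 ((hηd k j).memLp_of_hasCompactSupport
      (hasCompactSupport_partialDeriv (hηc k) j)))
    rw [zero_add] at this
    refine tendsto_of_tendsto_of_tendsto_of_le_of_le tendsto_const_nhds this (fun _ => zero_le)
      fun n => ?_
    refine (eLpNorm_add_le ((hη k).continuous.aestronglyMeasurable.smul (hφm' n j))
      ((hηd k j).aestronglyMeasurable.smul (hφm n)) (by norm_num)).trans ?_
    exact add_le_add (hle _) le_rfl
  have s3 : Tendsto (fun n => eLpNorm (fun x => ((axisDist x)⁻¹ * η k x) • (φ n x - U x)) 2 volume)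
      atTop (𝓝 0) := by
    refine mul3 ?_
    refine (((hη k).continuous.memLp_of_hasCompactSupport (hηc k)).const_mul δ⁻¹).of_le
      (hrm.mul (hη k).continuous.aestronglyMeasurable) (Eventually.of_forall fun x => ?_)
    rcases lt_or_ge (axisDist x) δ with hx | hx
    · simp [hδη x hx]
    · rw [norm_mul, norm_mul, norm_inv, norm_inv, Real.norm_of_nonneg (axisDist_nonneg x),
        Real.norm_of_nonneg hδ.le]
      gcongr
  obtain ⟨n, hn1, hn2, hn3⟩ := ((s1.eventually_lt_const hε2).and
    ((eventually_all.2 fun j => (s2 j).eventually_lt_const hε2).and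
      (s3.eventually_lt_const hε2))).exists
  refine ⟨fun x => η k x • φ n x, (hη k).smul (hφ n).1, (hηc k).smul_right,
    ⟨δ, hδ, fun x hx => by simp [hδη x hx]⟩, ?_, fun j => ?_, ?_⟩
  · rw [← ENNReal.add_halves ε]
    refine le_trans (le_of_eq ?_) ((eLpNorm_add_le
      ((hη k).continuous.aestronglyMeasurable.smul (hφm n))
      (((hη k).continuous.sub continuous_const).aestronglyMeasurable.smul hU.1)
      (by norm_num)).trans (add_le_add hn1.le hk1.le))
    congr 1; funext x
    simp only [Pi.add_apply, Pi.sub_apply, Pi.smul_apply']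
    module
  · rw [← ENNReal.add_halves ε]
    refine le_trans (le_of_eq ?_) ((eLpNorm_add_le
      (((hη k).continuous.aestronglyMeasurable.smul (hφm' n j)).add
        ((hηd k j).aestronglyMeasurable.smul (hφm n)))
      ((((hη k).continuous.sub continuous_const).aestronglyMeasurable.smul (hG j).1).add
        ((hηd k j).aestronglyMeasurable.smul hU.1))
      (by norm_num)).trans (add_le_add (hn2 j).le (hk2 j).le))
    congr 1; funext x
    rw [partialDeriv_smul ((hη k).differentiable (by simp) x)
      ((hφ n).1.differentiable (by simp) x)]
    simp only [Pi.add_apply, Pi.sub_apply, Pi.smul_apply']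
    module
  · rw [← ENNReal.add_halves ε]
    refine le_trans (le_of_eq ?_) ((eLpNorm_add_le
      ((hrm.mul (hη k).continuous.aestronglyMeasurable).smul (hφm n))
      (((hη k).continuous.sub continuous_const).aestronglyMeasurable.smul hr.1)
      (by norm_num)).trans (add_le_add hn3.le hk3.le))
    congr 1; funext x
    simp only [Pi.add_apply, Pi.sub_apply, Pi.smul_apply', Pi.mul_apply]
    module

/-! ### The scalar profile of a toroidal field -/

/-- The angular component `V · (-x₂, x₁, 0) / |x'|` of a vector `V` at the point `x`. -/
def angularPart (x V : E3) : ℝ := (x 0 * V 1 - x 1 * V 0) / axisDist x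

theorem angularPart_sub (x V W : E3) :
    angularPart x (V - W) = angularPart x V - angularPart x W := by
  simp [angularPart]; ring

theorem abs_angularPart_le (x V : E3) : |angularPart x V| ≤ ‖V‖ := by
  rcases (axisDist_nonneg x).eq_or_lt with hr | hr
  · simp [angularPart, ← hr]
  · rw [angularPart, abs_div, abs_of_pos hr, div_le_iff₀ hr]
    refine abs_le_of_sq_le_sq ?_ (by positivity)
    rw [mul_pow, axisDist_sq, norm_sq_eq_sum]
    nlinarith [sq_nonneg (x 0 * V 0 + x 1 * V 1), mul_nonneg (add_nonneg (sq_nonneg (x 0))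
      (sq_nonneg (x 1))) (sq_nonneg (V 2))]

theorem aestronglyMeasurable_angularPart {V : E3 → E3} (hV : AEStronglyMeasurable V volume) :
    AEStronglyMeasurable (fun x => angularPart x (V x)) volume := by
  have h (i : Fin 3) : AEStronglyMeasurable (fun x => V x i) volume :=
    (EuclideanSpace.proj (𝕜 := ℝ) i).continuous.comp_aestronglyMeasurable hV
  have hr : AEStronglyMeasurable (fun x => (axisDist x)⁻¹) (volume : Measure E3) :=
    continuous_axisDist.measurable.inv.aestronglyMeasurable
  simp only [angularPart, div_eq_mul_inv]
  exact (((continuous_coord 0).aestronglyMeasurable.mul (h 1)).sub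
    ((continuous_coord 1).aestronglyMeasurable.mul (h 0))).mul hr

theorem memLp_angularPart {V : E3 → E3} {p : ℝ≥0∞} (hV : MemLp V p volume) :
    MemLp (fun x => angularPart x (V x)) p volume :=
  hV.of_le (aestronglyMeasurable_angularPart hV.1)
    (Eventually.of_forall fun x => abs_angularPart_le x (V x))

theorem contDiffAt_axisDist {x : E3} (hx : 0 < axisDist x) : ContDiffAt ℝ ∞ axisDist x := by
  have h : ContDiffAt ℝ ∞ (fun y : E3 => y 0 ^ 2 + y 1 ^ 2) x := by fun_prop
  exact h.sqrt (by rw [← axisDist_sq]; positivity)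

/-- Only the frame `e_φ` is singular, and `Φ` vanishes where that happens. -/
theorem contDiff_angularPart {Φ : E3 → E3} (hΦ : ContDiff ℝ ∞ Φ) {δ : ℝ} (hδ : 0 < δ)
    (hΦδ : ∀ x, axisDist x < δ → Φ x = 0) : ContDiff ℝ ∞ fun x => angularPart x (Φ x) := by
  have hc (i : Fin 3) : ContDiff ℝ ∞ fun x => Φ x i := (contDiff_coord i).comp hΦ
  refine contDiff_iff_contDiffAt.2 fun x => ?_
  rcases (axisDist_nonneg x).eq_or_lt with hr | hr
  · have hnear : ∀ᶠ y in 𝓝 x, axisDist y < δ :=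
      continuous_axisDist.continuousAt.eventually_lt_const (by rwa [← hr])
    refine (contDiffAt_const (c := (0 : ℝ))).congr_of_eventuallyEq ?_
    filter_upwards [hnear] with y hy
    simp [angularPart, hΦδ y hy]
  · exact (((contDiff_coord 0).mul (hc 1)).sub ((contDiff_coord 1).mul (hc 0))).contDiffAt.div
      (contDiffAt_axisDist hr) hr.ne'

theorem partialDeriv_add {f g : E3 → ℝ} {x : E3} (hf : DifferentiableAt ℝ f x)
    (hg : DifferentiableAt ℝ g x) (j : Fin 3) :
    partialDeriv (fun y => f y + g y) j x = partialDeriv f j x + partialDeriv g j x := by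
  simp [partialDeriv, fderiv_fun_add hf hg]

theorem partialDeriv_sub {f g : E3 → ℝ} {x : E3} (hf : DifferentiableAt ℝ f x)
    (hg : DifferentiableAt ℝ g x) (j : Fin 3) :
    partialDeriv (fun y => f y - g y) j x = partialDeriv f j x - partialDeriv g j x := by
  simp [partialDeriv, fderiv_fun_sub hf hg]

theorem partialDeriv_axisDist {x : E3} (hx : 0 < axisDist x) (j : Fin 3) :
    partialDeriv axisDist j x * axisDist x = if j = 2 then 0 else x j := by
  have hd : DifferentiableAt ℝ axisDist x := (contDiffAt_axisDist hx).differentiableAt (by simp)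
  have h1 := partialDeriv_mul hd hd j
  have hdx (i : Fin 3) : DifferentiableAt ℝ (fun y : E3 => y i) x :=
    (contDiff_coord i).differentiable (by simp) x
  have h2 : partialDeriv (fun y => axisDist y * axisDist y) j x =
      partialDeriv (fun y : E3 => y 0 * y 0) j x + partialDeriv (fun y : E3 => y 1 * y 1) j x := by
    have : (fun y => axisDist y * axisDist y) = fun y : E3 => y 0 * y 0 + y 1 * y 1 := by
      funext y; simpa only [sq] using axisDist_sq y
    rw [this]
    exact partialDeriv_add ((hdx 0).mul (hdx 0)) ((hdx 1).mul (hdx 1)) j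
  rw [h1, partialDeriv_mul (hdx 0) (hdx 0), partialDeriv_mul (hdx 1) (hdx 1), partialDeriv_coord,
    partialDeriv_coord] at h2
  have h3 : partialDeriv axisDist j x * axisDist x =
      x 0 * (if (0 : Fin 3) = j then 1 else 0) + x 1 * (if (1 : Fin 3) = j then 1 else 0) := by
    linarith
  rw [h3]
  fin_cases j <;> simp

/-- The derivative of the angular part; the second term is the radial part of `Φ` divided by
`|x'|`, up to a bounded factor. -/
theorem abs_partialDeriv_angularPart_sub_le {Φ : E3 → E3} (hΦ : ContDiff ℝ ∞ Φ) {x : E3}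
    (hx : 0 < axisDist x) (j : Fin 3) {V : E3} (hV : x 0 * V 0 + x 1 * V 1 = 0) :
    |partialDeriv (fun y => angularPart y (Φ y)) j x - angularPart x (partialDeriv Φ j x)| ≤
      ‖(axisDist x)⁻¹ • (Φ x - V)‖ := by
  have hc (i : Fin 3) : ContDiff ℝ ∞ fun x => Φ x i := (contDiff_coord i).comp hΦ
  have hd : DifferentiableAt ℝ axisDist x := (contDiffAt_axisDist hx).differentiableAt (by simp)
  have hdx (i : Fin 3) : DifferentiableAt ℝ (fun y : E3 => y i) x :=
    (contDiff_coord i).differentiable (by simp) x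
  have hdΦ (i : Fin 3) : DifferentiableAt ℝ (fun y : E3 => Φ y i) x :=
    (hc i).differentiable (by simp) x
  have hdψ : DifferentiableAt ℝ (fun y => angularPart y (Φ y)) x :=
    ((((contDiff_coord 0).mul (hc 1)).sub ((contDiff_coord 1).mul (hc 0))).contDiffAt.div
      (contDiffAt_axisDist hx) hx.ne').differentiableAt (by simp)
  set r := axisDist x with hr
  have hr2 : r ^ 2 = x 0 ^ 2 + x 1 ^ 2 := axisDist_sq x
  -- Multiplication by `|x'|` clears the denominator, so the product rule on both sides determines
  -- `D`.
  have hprod : partialDeriv (fun y => angularPart y (Φ y) * axisDist y) j x =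
      partialDeriv (fun y : E3 => y 0 * Φ y 1) j x -
        partialDeriv (fun y : E3 => y 1 * Φ y 0) j x := by
    have he : (fun y => angularPart y (Φ y) * axisDist y) =ᶠ[𝓝 x]
        fun y => y 0 * Φ y 1 - y 1 * Φ y 0 := by
      filter_upwards [continuous_axisDist.continuousAt.eventually_const_lt hx] with y hy
      exact div_mul_cancel₀ _ hy.ne'
    refine Eq.trans ?_ (partialDeriv_sub ((hdx 0).mul (hdΦ 1)) ((hdx 1).mul (hdΦ 0)) j)
    simp only [partialDeriv]
    rw [he.fderiv_eq]
    rfl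
  rw [partialDeriv_mul hdψ hd, partialDeriv_mul (hdx 0) (hdΦ 1), partialDeriv_mul (hdx 1) (hdΦ 0),
    partialDeriv_coord, partialDeriv_coord,
    partialDeriv_apply (hΦ.differentiable (by simp) x),
    partialDeriv_apply (hΦ.differentiable (by simp) x), ← hr] at hprod
  have hrj := partialDeriv_axisDist hx j
  rw [← hr] at hrj
  set D := partialDeriv (fun y => angularPart y (Φ y)) j x
  set P := Φ x - V with hP
  have hrad : x 0 * Φ x 0 + x 1 * Φ x 1 = x 0 * P 0 + x 1 * P 1 := by
    simp only [hP, PiLp.sub_apply]; linarith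
  have hψ : angularPart x (Φ x) * r = x 0 * Φ x 1 - x 1 * Φ x 0 := div_mul_cancel₀ _ hx.ne'
  have hA : angularPart x (partialDeriv Φ j x) * r =
      x 0 * partialDeriv Φ j x 1 - x 1 * partialDeriv Φ j x 0 := div_mul_cancel₀ _ hx.ne'
  have hcs : (x 0 * P 0 + x 1 * P 1) ^ 2 ≤ r ^ 2 * ‖P‖ ^ 2 := by
    rw [hr2, norm_sq_eq_sum]
    nlinarith [sq_nonneg (x 0 * P 1 - x 1 * P 0), mul_nonneg (add_nonneg (sq_nonneg (x 0))
      (sq_nonneg (x 1))) (sq_nonneg (P 2))]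
  -- The derivative of `e_φ` is radial and of size at most `1/r`, so the error is `c (x₁P₁ +
  -- x₂P₂)/r³` with `c² ≤ r²`. Subtracting `V` is free because `V` has no radial part.
  have hbound (c : ℝ) (hc : c ^ 2 ≤ r ^ 2)
      (h : (D - angularPart x (partialDeriv Φ j x)) * r ^ 3 = c * (x 0 * P 0 + x 1 * P 1)) :
      |D - angularPart x (partialDeriv Φ j x)| ≤ ‖r⁻¹ • P‖ := by
    rw [norm_smul, norm_inv, Real.norm_of_nonneg hx.le, inv_mul_eq_div, le_div_iff₀ hx]
    have h4 : ((D - angularPart x (partialDeriv Φ j x)) * r) ^ 2 * r ^ 4 ≤ ‖P‖ ^ 2 * r ^ 4 := by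
      calc _ = c ^ 2 * (x 0 * P 0 + x 1 * P 1) ^ 2 := by rw [← mul_pow, ← h]; ring
        _ ≤ r ^ 2 * (r ^ 2 * ‖P‖ ^ 2) := by gcongr
        _ = _ := by ring
    have h5 := abs_le_of_sq_le_sq (le_of_mul_le_mul_right h4 (by positivity)) (norm_nonneg P)
    rwa [abs_mul, abs_of_pos hx] at h5
  have hmain : (D - angularPart x (partialDeriv Φ j x)) * r ^ 3 =
      r ^ 2 * ((if (0 : Fin 3) = j then 1 else 0) * Φ x 1 -
        (if (1 : Fin 3) = j then 1 else 0) * Φ x 0) -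
        (x 0 * Φ x 1 - x 1 * Φ x 0) * (partialDeriv axisDist j x * r) := by
    linear_combination r ^ 2 * hprod - r ^ 2 * hA - r * partialDeriv axisDist j x * hψ
  rw [hrj, hr2] at hmain
  fin_cases j
  · refine hbound (x 1) (by nlinarith [sq_nonneg (x 0)]) ?_
    rw [hmain, ← hrad]; simp; ring
  · refine hbound (-x 0) (by nlinarith [sq_nonneg (x 1)]) ?_
    rw [hmain, ← hrad]; simp; ring
  · refine hbound 0 (by simpa using sq_nonneg r) ?_
    rw [hmain]; simp

section Toroidal

variable {u : E3 → ℝ} {U : E3 → E3} {G : Fin 3 → E3 → E3}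

theorem ae_eq_angularPart_of_toroidal
    (hU : U =ᵐ[volume] fun x => (u x / axisDist x) • (!₂[-(x 1), x 0, 0] : E3)) :
    (fun x => angularPart x (U x)) =ᵐ[volume] u := by
  filter_upwards [toroidal_apply hU, ae_axisDist_pos] with x hx hr
  rw [angularPart, hx.1, hx.2.1, div_eq_iff hr.ne']
  have h2 := axisDist_sq x
  have h3 : u x / axisDist x * axisDist x = u x := div_mul_cancel₀ _ hr.ne'
  linear_combination (-(u x / axisDist x)) * h2 + axisDist x * h3

theorem norm_ae_eq_of_toroidal
    (hU : U =ᵐ[volume] fun x => (u x / axisDist x) • (!₂[-(x 1), x 0, 0] : E3)) :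
    ∀ᵐ x, ‖U x‖ = |u x| := by
  filter_upwards [toroidal_apply hU, ae_axisDist_pos] with x hx hr
  refine (sq_eq_sq₀ (norm_nonneg _) (abs_nonneg _)).1 ?_
  have h2 := axisDist_sq x
  have h3 : u x / axisDist x * axisDist x = u x := div_mul_cancel₀ _ hr.ne'
  rw [norm_sq_eq_sum, hx.1, hx.2.1, hx.2.2, sq_abs]
  calc _ = (u x / axisDist x) ^ 2 * axisDist x ^ 2 := by rw [h2]; ring
    _ = u x ^ 2 := by rw [← mul_pow, h3]

/-- A Hardy type bound that symmetry supplies pointwise: `|U|/|x'|` is at most the length of the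
full gradient. -/
theorem HasD12Gradient.memLp_div_axisDist_of_toroidal (h : HasD12Gradient U G)
    (hu : IsSOInvariant u)
    (hU : U =ᵐ[volume] fun x => (u x / axisDist x) • (!₂[-(x 1), x 0, 0] : E3)) :
    MemLp (fun x => (axisDist x)⁻¹ • U x) 2 volume := by
  have hG : MemLp (fun x => ∑ j, ‖G j x‖) 2 volume :=
    memLp_finsetSum _ fun j _ => (h.2.1 j).norm
  refine hG.of_le (continuous_axisDist.measurable.inv.aestronglyMeasurable.smul h.1.1) ?_
  filter_upwards [h.energy_density_le hu hU, norm_ae_eq_of_toroidal hU] with x hx hn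
  rw [Real.norm_of_nonneg (Finset.sum_nonneg fun _ _ => norm_nonneg _)]
  refine abs_le_of_sq_le_sq' ?_ (Finset.sum_nonneg fun _ _ => norm_nonneg _) |>.2
  have h1 : ‖(axisDist x)⁻¹ • U x‖ ^ 2 = u x ^ 2 / axisDist x ^ 2 := by
    rw [norm_smul, hn, mul_pow, sq_abs, norm_inv, Real.norm_of_nonneg (axisDist_nonneg x)]
    ring
  rw [h1]
  have h2 : 0 ≤ ∑ j, profileGradient G j x ^ 2 := Finset.sum_nonneg fun _ _ => sq_nonneg _
  refine (le_add_of_nonneg_left h2).trans (hx.trans ?_)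
  exact Finset.sum_sq_le_sq_sum_of_nonneg fun _ _ => norm_nonneg _

/-- The profile of a toroidal field in `D^{1,2}` belongs to `X_SO`. -/
theorem HasD12Gradient.memXSO_of_toroidal (h : HasD12Gradient U G) (hu : IsSOInvariant u)
    (hU : U =ᵐ[volume] fun x => (u x / axisDist x) • (!₂[-(x 1), x 0, 0] : E3)) :
    MemXSO u (profileGradient G) := by
  have hr := h.memLp_div_axisDist_of_toroidal hu hU
  have hua := ae_eq_angularPart_of_toroidal hU
  refine ⟨hasD12Gradient_of_approx ((memLp_congr_ae hua).1 (memLp_angularPart h.1))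
    (fun j => memLp_angularPart (h.2.1 j)) fun ε hε => ?_, ?_, hu⟩
  · obtain ⟨Φ, hΦ, hΦc, ⟨δ, hδ, hΦδ⟩, h6, h2, h2'⟩ :=
      h.exists_approx_offAxis hr (ENNReal.half_pos hε.ne')
    refine ⟨fun x => angularPart x (Φ x), contDiff_angularPart hΦ hδ hΦδ, ?_, ?_, fun j => ?_⟩
    · exact hΦc.mono fun x hx hx' => hx (by simp [angularPart, hx'])
    · refine (eLpNorm_mono_ae ?_).trans (h6.trans ENNReal.half_le_self)
      filter_upwards [hua] with x hx
      rw [← hx, ← angularPart_sub]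
      exact abs_angularPart_le _ _
    · have hm1 : AEStronglyMeasurable (fun x => ‖partialDeriv Φ j x - G j x‖) volume :=
        ((contDiff_partialDeriv hΦ j).continuous.aestronglyMeasurable.sub (h.2.1 j).1).norm
      have hm2 : AEStronglyMeasurable (fun x => ‖(axisDist x)⁻¹ • (Φ x - U x)‖) volume :=
        (continuous_axisDist.measurable.inv.aestronglyMeasurable.smul
          (hΦ.continuous.aestronglyMeasurable.sub h.1.1)).norm
      calc _ ≤ eLpNorm ((fun x => ‖partialDeriv Φ j x - G j x‖) +
              fun x => ‖(axisDist x)⁻¹ • (Φ x - U x)‖) 2 volume := by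
            refine eLpNorm_mono_ae ?_
            filter_upwards [toroidal_apply hU, ae_axisDist_pos] with x hx hx0
            -- As `U x` is purely angular it is an admissible `V`; the error becomes `|Φ - U|/|x'|`,
            -- which is small in `L²`.
            have e1 := abs_partialDeriv_angularPart_sub_le hΦ hx0 j (V := U x)
              (by rw [hx.1, hx.2.1]; ring)
            have e2 := abs_angularPart_le x (partialDeriv Φ j x - G j x)
            rw [angularPart_sub] at e2
            rw [Real.norm_eq_abs, Real.norm_of_nonneg (by simp only [Pi.add_apply]; positivity)]
            refine (abs_sub_le _ (angularPart x (partialDeriv Φ j x)) _).trans ?_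
            simp only [Pi.add_apply]
            rw [add_comm]
            exact add_le_add e2 e1
        _ ≤ ε / 2 + ε / 2 := by
            refine (eLpNorm_add_le hm1 hm2 (by norm_num)).trans (add_le_add ?_ ?_)
            · rw [eLpNorm_norm]; exact h2 j
            · rw [eLpNorm_norm]; exact h2'
        _ = ε := ENNReal.add_halves ε
  · refine (hr.integrable_norm_pow (by simp)).congr ?_
    filter_upwards [norm_ae_eq_of_toroidal hU] with x hn
    rw [norm_smul, hn, norm_inv, Real.norm_of_nonneg (axisDist_nonneg x)]
    rw [mul_pow, sq_abs]
    ring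

/-- With zero divergence the curl carries the whole Dirichlet integral, and the pointwise density
bound integrates. -/
theorem HasD12Gradient.energy_le_of_toroidal (h : HasD12Gradient U G) (hu : IsSOInvariant u)
    (hU : U =ᵐ[volume] fun x => (u x / axisDist x) • (!₂[-(x 1), x 0, 0] : E3)) :
    energy u (profileGradient G) ≤ ∫ x, inner ℝ (curl G x) (curl G x) := by
  have hX := h.memXSO_of_toroidal hu hU
  have hdiv : ∫ x, (G 0 x 0 + G 1 x 1 + G 2 x 2) ^ 2 = 0 := by
    rw [integral_eq_zero_of_ae]
    filter_upwards [h.div_eq_zero_of_toroidal hu hU] with x hx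
    simp [hx]
  have hc := h.integral_norm_curl_sq
  rw [hdiv, add_zero] at hc
  rw [← hc]
  exact integral_mono_ae
    ((integrable_finsetSum _ fun j _ => (hX.1.2.1 j).integrable_sq).add hX.2.1)
    (integrable_finsetSum _ fun j _ => (h.2.1 j).integrable_norm_pow (by simp))
    (h.energy_density_le hu hU)

end Toroidal

/-! ### Interpolation of weighted integrals -/

/-- The integral `∫ f^{6-2s} / |x|^s` of a function with values in `[0, ∞]`. -/
def weightedLIntegral (s : ℝ) (f : E3 → ℝ≥0∞) : ℝ≥0∞ :=
  ∫⁻ x, f x ^ (6 - 2 * s) * ‖x‖ₑ⁻¹ ^ s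

theorem aemeasurable_weighted {s : ℝ} {f : E3 → ℝ≥0∞} (hf : AEMeasurable f volume) :
    AEMeasurable (fun x => f x ^ (6 - 2 * s) * ‖x‖ₑ⁻¹ ^ s) volume :=
  (hf.pow_const _).mul (measurable_enorm.inv.pow_const _).aemeasurable

/-- Log-convexity of the weighted integrals in `s`. -/
theorem weightedLIntegral_interpolate {s t : ℝ} (ht : 0 ≤ t) (hts : t ≤ s) (hs : s ≤ 2)
    (ht2 : t < 2) {f : E3 → ℝ≥0∞} (hf : AEMeasurable f volume) :
    weightedLIntegral s f ≤ weightedLIntegral 2 f ^ ((s - t) / (2 - t)) *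
      weightedLIntegral t f ^ ((2 - s) / (2 - t)) := by
  have h2t : 0 < 2 - t := by linarith
  have hp : 0 ≤ (s - t) / (2 - t) := div_nonneg (by linarith) h2t.le
  have hq : 0 ≤ (2 - s) / (2 - t) := div_nonneg (by linarith) h2t.le
  -- Here `s` is the convex combination of `2` and `t` with these weights; `6 - 2s` is affine in
  -- `s`, so the powers of `f` match as well.
  refine le_trans (le_of_eq ?_) (ENNReal.lintegral_mul_norm_pow_le
    (aemeasurable_weighted (s := 2) hf) (aemeasurable_weighted (s := t) hf) hp hq
    (by field_simp; ring))
  refine lintegral_congr fun x => ?_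
  rw [ENNReal.mul_rpow_of_nonneg _ _ hp, ENNReal.mul_rpow_of_nonneg _ _ hq, ← ENNReal.rpow_mul,
    ← ENNReal.rpow_mul, ← ENNReal.rpow_mul, ← ENNReal.rpow_mul, mul_mul_mul_comm,
    ← ENNReal.rpow_add_of_nonneg, ← ENNReal.rpow_add_of_nonneg]
  · congr 2 <;> field_simp <;> ring
  · positivity
  · positivity
  · exact mul_nonneg (by norm_num) hp
  · exact mul_nonneg (by linarith) hq

/-- Hölder for the measure `|x|^{-s} dx` with exponents `(6-2s)/(5-2s)` and `6-2s`; it controls the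
nonlinear term paired with a test field. -/
theorem lintegral_weighted_mul_le {s : ℝ} (hs2 : s < 2) (hs0 : 0 ≤ s)
    {f g : E3 → ℝ≥0∞} (hf : AEMeasurable f volume) (hg : AEMeasurable g volume) :
    ∫⁻ x, f x ^ (5 - 2 * s) * g x * ‖x‖ₑ⁻¹ ^ s ≤
      weightedLIntegral s f ^ ((5 - 2 * s) / (6 - 2 * s)) *
        weightedLIntegral s g ^ (1 / (6 - 2 * s)) := by
  have h6 : 0 < 6 - 2 * s := by linarith
  have hp : 0 ≤ (5 - 2 * s) / (6 - 2 * s) := div_nonneg (by linarith) h6.le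
  have hq : 0 ≤ 1 / (6 - 2 * s) := div_nonneg zero_le_one h6.le
  refine le_trans (le_of_eq ?_) (ENNReal.lintegral_mul_norm_pow_le
    (aemeasurable_weighted (s := s) hf) (aemeasurable_weighted (s := s) hg) hp hq
    (by field_simp; ring))
  refine lintegral_congr fun x => ?_
  rw [ENNReal.mul_rpow_of_nonneg _ _ hp, ENNReal.mul_rpow_of_nonneg _ _ hq, ← ENNReal.rpow_mul,
    ← ENNReal.rpow_mul, ← ENNReal.rpow_mul, ← ENNReal.rpow_mul, mul_mul_mul_comm,
    ← ENNReal.rpow_add_of_nonneg, mul_one_div_cancel h6.ne', ENNReal.rpow_one,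
    mul_div_cancel₀ _ h6.ne']
  · have hpq : (5 - 2 * s) / (6 - 2 * s) + 1 / (6 - 2 * s) = 1 := by field_simp; ring
    rw [← mul_add, hpq, mul_one]
  · positivity
  · positivity

section

variable {F : Type*} [NormedAddCommGroup F] [NormedSpace ℝ F]

theorem weightedLIntegral_zero {F : Type*} [NormedAddCommGroup F] (V : E3 → F) :
    weightedLIntegral 0 (fun x => ‖V x‖ₑ) = eLpNorm V 6 volume ^ (6 : ℝ) := by
  rw [eLpNorm_eq_lintegral_rpow_enorm_toReal (by simp) (by simp), ← ENNReal.rpow_mul]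
  simp [weightedLIntegral]

theorem weightedLIntegral_two_le (V : E3 → F) :
    weightedLIntegral 2 (fun x => ‖V x‖ₑ) ≤
      eLpNorm (fun x => (axisDist x)⁻¹ • V x) 2 volume ^ (2 : ℝ) := by
  rw [eLpNorm_eq_lintegral_rpow_enorm_toReal (by simp) (by simp), ← ENNReal.rpow_mul]
  simp only [ENNReal.toReal_ofNat, one_div, isUnit_iff_ne_zero, ne_eq, OfNat.ofNat_ne_zero,
    not_false_eq_true, IsUnit.inv_mul_cancel, ENNReal.rpow_one]
  refine lintegral_mono_ae ?_
  filter_upwards [ae_axisDist_pos] with x hx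
  rw [enorm_smul, ENNReal.mul_rpow_of_nonneg _ _ (by norm_num), mul_comm]
  have h : ‖x‖ₑ⁻¹ ≤ ‖(axisDist x)⁻¹‖ₑ := by
    rw [enorm_inv hx.ne']
    refine ENNReal.inv_le_inv.2 (enorm_le_iff_norm_le.2 ?_)
    rw [Real.norm_of_nonneg hx.le]
    exact axisDist_le_norm x
  norm_num
  gcongr

/-- Interpolation between `s = 0`, the `L⁶` norm, and `s = 2`, controlled by `V/|x'|` in `L²`. The
powers add up to `2 (s/2) + 6 (2-s)/2 = 6 - 2s`. -/
theorem weightedLIntegral_le {s : ℝ} (hs0 : 0 ≤ s) (hs2 : s < 2) {V : E3 → F}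
    (hV : AEStronglyMeasurable V volume) {ε : ℝ≥0∞} (h6 : eLpNorm V 6 volume ≤ ε)
    (h2 : eLpNorm (fun x => (axisDist x)⁻¹ • V x) 2 volume ≤ ε) :
    weightedLIntegral s (fun x => ‖V x‖ₑ) ≤ ε ^ (6 - 2 * s) := by
  refine (weightedLIntegral_interpolate le_rfl hs0 hs2.le (by norm_num) hV.enorm).trans ?_
  rw [weightedLIntegral_zero]
  calc _ ≤ (ε ^ (2 : ℝ)) ^ ((s - 0) / (2 - 0)) * (ε ^ (6 : ℝ)) ^ ((2 - s) / (2 - 0)) := by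
        have hp : 0 ≤ (s - 0) / (2 - 0) := div_nonneg (by linarith) (by norm_num)
        have hq : 0 ≤ (2 - s) / (2 - 0) := div_nonneg (by linarith) (by norm_num)
        have h2' := weightedLIntegral_two_le V
        gcongr
        exact h2'.trans (by gcongr)
    _ = ε ^ (6 - 2 * s) := by
        rw [← ENNReal.rpow_mul, ← ENNReal.rpow_mul, ← ENNReal.rpow_add_of_nonneg]
        · congr 1; ring
        · linarith
        · linarith

theorem weightedLIntegral_lt_top {s : ℝ} (hs0 : 0 ≤ s) (hs2 : s < 2) {V : E3 → F}
    (h6 : MemLp V 6 volume) (h2 : MemLp (fun x => (axisDist x)⁻¹ • V x) 2 volume) :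
    weightedLIntegral s (fun x => ‖V x‖ₑ) < ⊤ :=
  (weightedLIntegral_le hs0 hs2 h6.1 (le_max_left _ _) (le_max_right _ _)).trans_lt
    (ENNReal.rpow_lt_top_of_nonneg (by linarith) (max_lt h6.2 h2.2).ne)

end

theorem ae_norm_pos : ∀ᵐ x : E3, 0 < ‖x‖ := by
  filter_upwards [ae_axisDist_pos] with x hx using hx.trans_le (axisDist_le_norm x)

theorem enorm_weight {s : ℝ} {x : E3} (hx : 0 < ‖x‖) : ‖x‖ₑ⁻¹ ^ s = ENNReal.ofReal (‖x‖ ^ s)⁻¹ := by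
  rw [ENNReal.ofReal_inv_of_pos (by positivity), ← ENNReal.ofReal_rpow_of_pos hx, ofReal_norm,
    ENNReal.inv_rpow]

theorem weightedIntegral_eq_toReal {s : ℝ} (hs : s < 3) {u : E3 → ℝ}
    (hu : AEStronglyMeasurable u volume) :
    weightedIntegral s u = (weightedLIntegral s fun x => ‖u x‖ₑ).toReal := by
  have hm : AEStronglyMeasurable (fun x : E3 => |u x| ^ (6 - 2 * s) / ‖x‖ ^ s) volume :=
    ((hu.norm.aemeasurable.pow_const _).div
      (measurable_norm.pow_const _).aemeasurable).aestronglyMeasurable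
  rw [weightedIntegral, integral_eq_lintegral_of_nonneg_ae
    (Eventually.of_forall fun x => by positivity) hm]
  congr 1
  refine lintegral_congr_ae ?_
  filter_upwards [ae_norm_pos] with x hx
  rw [div_eq_mul_inv, ENNReal.ofReal_mul (by positivity), ← enorm_weight hx,
    ← ENNReal.ofReal_rpow_of_nonneg (abs_nonneg _) (by linarith), ← Real.norm_eq_abs, ofReal_norm]

/-! ### The Caffarelli-Kohn-Nirenberg type inequality -/

section CKN

variable {u : E3 → ℝ} {G : Fin 3 → E3 → ℝ}

theorem MemXSO.memLp_div_axisDist (h : MemXSO u G) :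
    MemLp (fun x => (axisDist x)⁻¹ • u x) 2 volume := by
  refine (memLp_two_iff_integrable_sq
    (continuous_axisDist.measurable.inv.aestronglyMeasurable.smul h.1.1.1)).2 (h.2.1.congr ?_)
  refine Eventually.of_forall fun x => ?_
  simp only [Pi.smul_apply', smul_eq_mul, Pi.inv_apply]
  ring

theorem MemXSO.weightedLIntegral_lt_top (h : MemXSO u G) {s : ℝ} (hs0 : 0 ≤ s) (hs2 : s < 2) :
    weightedLIntegral s (fun x => ‖u x‖ₑ) < ⊤ :=
  Maxwell.weightedLIntegral_lt_top hs0 hs2 h.1.1 h.memLp_div_axisDist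

theorem energy_nonneg : 0 ≤ energy u G :=
  integral_nonneg fun x => add_nonneg (Finset.sum_nonneg fun _ _ => sq_nonneg _) (by positivity)

theorem weightedIntegral_nonneg (s : ℝ) : 0 ≤ weightedIntegral s u :=
  integral_nonneg fun x => by positivity

theorem MemXSO.weightedLIntegral_two_le_energy (h : MemXSO u G) :
    weightedLIntegral 2 (fun x => ‖u x‖ₑ) ≤ ENNReal.ofReal (energy u G) := by
  have hi : Integrable fun x => (∑ j, G j x ^ 2) + u x ^ 2 / axisDist x ^ 2 :=
    (integrable_finsetSum _ fun j _ => (h.1.2.1 j).integrable_sq).add h.2.1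
  rw [energy, ofReal_integral_eq_lintegral_ofReal hi (Eventually.of_forall fun x =>
    add_nonneg (Finset.sum_nonneg fun _ _ => sq_nonneg _) (by positivity))]
  refine lintegral_mono_ae ?_
  filter_upwards [ae_axisDist_pos] with x hx
  have hx' : 0 < ‖x‖ := hx.trans_le (axisDist_le_norm x)
  rw [enorm_weight hx', ← ofReal_norm, ENNReal.ofReal_rpow_of_nonneg (norm_nonneg _) (by norm_num),
    ← ENNReal.ofReal_mul (by positivity)]
  refine ENNReal.ofReal_le_ofReal ?_
  have h1 : 0 ≤ ∑ j, G j x ^ 2 := Finset.sum_nonneg fun _ _ => sq_nonneg _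
  refine le_trans ?_ (le_add_of_nonneg_left h1)
  norm_num
  rw [div_eq_mul_inv]
  have := axisDist_le_norm x
  gcongr

theorem MemXSO.weightedIntegral_le (h : MemXSO u G) {s₁ s₂ : ℝ} (hs₂ : 0 ≤ s₂) (hs : s₂ < s₁)
    (hs₁ : s₁ < 2) : weightedIntegral s₁ u ≤
      energy u G ^ ((s₁ - s₂) / (2 - s₂)) * weightedIntegral s₂ u ^ ((2 - s₁) / (2 - s₂)) := by
  have hm := h.1.1.1
  have hp : 0 ≤ (s₁ - s₂) / (2 - s₂) := div_nonneg (by linarith) (by linarith)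
  have hq : 0 ≤ (2 - s₁) / (2 - s₂) := div_nonneg (by linarith) (by linarith)
  rw [weightedIntegral_eq_toReal (by linarith) hm, weightedIntegral_eq_toReal (by linarith) hm,
    ENNReal.toReal_rpow, ← ENNReal.toReal_ofReal (energy_nonneg (u := u) (G := G)),
    ENNReal.toReal_rpow, ← ENNReal.toReal_mul]
  refine ENNReal.toReal_mono (ENNReal.mul_ne_top
    (ENNReal.rpow_ne_top_of_nonneg hp ENNReal.ofReal_ne_top)
    (ENNReal.rpow_ne_top_of_nonneg hq (h.weightedLIntegral_lt_top hs₂ (by linarith)).ne)) ?_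
  refine (weightedLIntegral_interpolate hs₂ hs.le hs₁.le (by linarith) hm.enorm).trans ?_
  gcongr
  exact h.weightedLIntegral_two_le_energy

/-- The root of order `6 - 2s₁` of the interpolation inequality turns the exponent `(s₁-s₂)/(2-s₂)`
of the energy into `a₀/2`. -/
theorem one_mem_cknConstants {s₁ s₂ : ℝ} (hs₂ : 0 ≤ s₂) (hs : s₂ < s₁) (hs₁ : s₁ < 2) :
    1 ∈ cknConstants s₁ s₂ := by
  refine ⟨zero_le_one, fun u G h => ?_⟩
  have h6 : 0 < 6 - 2 * s₁ := by linarith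
  have hE := energy_nonneg (u := u) (G := G)
  have hW := weightedIntegral_nonneg (u := u) s₂
  have h1 := Real.rpow_le_rpow (weightedIntegral_nonneg s₁) (h.weightedIntegral_le hs₂ hs hs₁)
    (one_div_pos.2 h6).le
  refine h1.trans (le_of_eq ?_)
  rw [Real.mul_rpow (Real.rpow_nonneg hE _) (Real.rpow_nonneg hW _), ← Real.rpow_mul hE,
    ← Real.rpow_mul hW, one_mul, cknExponent]
  have e1 : 2 - s₂ ≠ 0 := by linarith
  have e2 : 3 - s₁ ≠ 0 := by linarith
  have e3 : 6 - 2 * s₁ ≠ 0 := h6.ne'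
  have e4 : 6 - 2 * s₂ ≠ 0 := by linarith
  congr 2
  · rw [show 6 - 2 * s₁ = 2 * (3 - s₁) by ring]; field_simp
  · rw [show 6 - 2 * s₁ = 2 * (3 - s₁) by ring, show 6 - 2 * s₂ = 2 * (3 - s₂) by ring]
    have e5 : 3 - s₂ ≠ 0 := by linarith
    field_simp
    ring

/-- Each function in `X_SO` imposes a closed condition on `S`, so the infimum is attained. -/
theorem isLeast_Sbar {s₁ s₂ : ℝ} (hs₂ : 0 ≤ s₂) (hs : s₂ < s₁) (hs₁ : s₁ < 2) :
    IsLeast (cknConstants s₁ s₂) (Sbar s₁ s₂) := by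
  have hb : BddBelow (cknConstants s₁ s₂) := ⟨0, fun S hS => hS.1⟩
  refine ⟨IsClosed.csInf_mem ?_ ⟨1, one_mem_cknConstants hs₂ hs hs₁⟩ hb, fun S hS => csInf_le hb hS⟩
  have : cknConstants s₁ s₂ = Set.Ici 0 ∩ ⋂ (u : E3 → ℝ) (G : Fin 3 → E3 → ℝ) (_ : MemXSO u G),
      {S | weightedIntegral s₁ u ^ (1 / (6 - 2 * s₁)) ≤ S * energy u G ^ (cknExponent s₁ s₂ / 2) *
        weightedIntegral s₂ u ^ ((1 - cknExponent s₁ s₂) / (6 - 2 * s₂))} := by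
    ext S; simp [cknConstants]
  rw [this]
  refine isClosed_Ici.inter (isClosed_iInter fun u => isClosed_iInter fun G => isClosed_iInter
    fun _ => isClosed_le continuous_const (by fun_prop))

theorem Sbar_le_one {s₁ s₂ : ℝ} (hs₂ : 0 ≤ s₂) (hs : s₂ < s₁) (hs₁ : s₁ < 2) :
    Sbar s₁ s₂ ≤ 1 := (isLeast_Sbar hs₂ hs hs₁).2 (one_mem_cknConstants hs₂ hs hs₁)

theorem MemXSO.weightedIntegral_le_Sbar (h : MemXSO u G) {s₁ s₂ : ℝ} (hs₂ : 0 ≤ s₂) (hs : s₂ < s₁)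
    (hs₁ : s₁ < 2) : weightedIntegral s₁ u ≤ Sbar s₁ s₂ ^ (6 - 2 * s₁) *
      (energy u G ^ ((s₁ - s₂) / (2 - s₂)) * weightedIntegral s₂ u ^ ((2 - s₁) / (2 - s₂))) := by
  obtain ⟨hS0, hS⟩ := (isLeast_Sbar hs₂ hs hs₁).1
  have h6 : 0 < 6 - 2 * s₁ := by linarith
  have hE := energy_nonneg (u := u) (G := G)
  have hW := weightedIntegral_nonneg (u := u) s₂
  have h1 := Real.rpow_le_rpow (Real.rpow_nonneg (weightedIntegral_nonneg s₁) _) (hS u G h) h6.le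
  rw [← Real.rpow_mul (weightedIntegral_nonneg s₁), one_div_mul_cancel h6.ne', Real.rpow_one] at h1
  refine h1.trans (le_of_eq ?_)
  rw [Real.mul_rpow (mul_nonneg hS0 (Real.rpow_nonneg hE _)) (Real.rpow_nonneg hW _),
    Real.mul_rpow hS0 (Real.rpow_nonneg hE _), ← Real.rpow_mul hE, ← Real.rpow_mul hW, mul_assoc,
    cknExponent]
  have e1 : 2 - s₂ ≠ 0 := by linarith
  have e2 : 3 - s₁ ≠ 0 := by linarith
  have e5 : 3 - s₂ ≠ 0 := by linarith
  congr 3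
  · rw [show 6 - 2 * s₁ = 2 * (3 - s₁) by ring]; field_simp
  · rw [show 6 - 2 * s₁ = 2 * (3 - s₁) by ring, show 6 - 2 * s₂ = 2 * (3 - s₂) by ring]
    field_simp
    ring

end CKN

/-! ### Positivity of the best constant and the inequality behind `λ*` -/

theorem MemXSO.ae_eq_zero {u : E3 → ℝ} {G : Fin 3 → E3 → ℝ} (h : MemXSO u G) {s : ℝ} (hs0 : 0 ≤ s)
    (hs2 : s < 2) (hW : weightedIntegral s u = 0) : u =ᵐ[volume] 0 := by
  rw [weightedIntegral_eq_toReal (by linarith) h.1.1.1, ENNReal.toReal_eq_zero_iff,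
    or_iff_left (h.weightedLIntegral_lt_top hs0 hs2).ne, weightedLIntegral,
    lintegral_eq_zero_iff' (aemeasurable_weighted h.1.1.1.enorm)] at hW
  filter_upwards [hW] with x hx
  simp only [Pi.zero_apply, mul_eq_zero, ENNReal.rpow_eq_zero_iff] at hx
  have h6 : 0 < 6 - 2 * s := by linarith
  rcases hx with (hx | hx) | (hx | hx)
  · simpa using hx.1
  · exact absurd hx.2 (by linarith)
  · simp at hx
  · exact absurd hx.2 (by linarith)

theorem HasD12Gradient.of_contDiff {F : Type*} [NormedAddCommGroup F] [NormedSpace ℝ F] {φ : E3 → F}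
    (hφ : ContDiff ℝ ∞ φ) (hφc : HasCompactSupport φ) : HasD12Gradient φ (partialDeriv φ) :=
  ⟨hφ.continuous.memLp_of_hasCompactSupport hφc,
    fun j => (contDiff_partialDeriv hφ j).continuous.memLp_of_hasCompactSupport
      (hasCompactSupport_partialDeriv hφc j),
    fun _ => φ, fun _ => ⟨hφ, hφc⟩, by simp, fun j => by simp⟩

/-- A cutoff supplies a nonzero member of `X_SO`: it vanishes where `N|x'|² ≤ 1`, so `η²/|x'|² ≤ N
η²`. -/
theorem memXSO_cutoff {N : ℝ} (hN : 0 < N) : MemXSO (cutoff N) (partialDeriv (cutoff N)) := by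
  have hc := (contDiff_cutoff N).continuous
  refine ⟨.of_contDiff (contDiff_cutoff N) (hasCompactSupport_cutoff hN), ?_, fun g hg x => ?_⟩
  · have hi : Integrable fun x => N * cutoff N x ^ 2 :=
      ((hc.memLp_of_hasCompactSupport (hasCompactSupport_cutoff hN)).integrable_sq).const_mul N
    refine hi.mono' ((hc.measurable.pow_const 2).div
      (continuous_axisDist.measurable.pow_const 2)).aestronglyMeasurable
      (Eventually.of_forall fun x => ?_)
    rw [Real.norm_of_nonneg (by positivity)]
    rcases le_or_gt (N * axisDist x ^ 2) 1 with hx | hx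
    · simp [cutoff_eq_zero_of_axisDist hx]
    · have hr : 0 < axisDist x ^ 2 := pos_of_mul_pos_right (one_pos.trans hx) hN.le
      rw [div_le_iff₀ hr]
      nlinarith [sq_nonneg (cutoff N x)]
  · rw [cutoff, cutoff, ← norm_sq_eq_sum, ← norm_sq_eq_sum, ← axisDist_sq, ← axisDist_sq,
      axisDist_eq_of_isometry g hg, g.norm_map]

theorem Sbar_pos {s₁ s₂ : ℝ} (hs₂ : 0 ≤ s₂) (hs : s₂ < s₁) (hs₁ : s₁ < 2) : 0 < Sbar s₁ s₂ := by
  refine lt_of_le_of_ne (isLeast_Sbar hs₂ hs hs₁).1.1 fun h0 => ?_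
  -- For `N = 4` both factors of the cutoff are positive at the first unit vector, their arguments
  -- being `3` and `7/4`. A zero best constant would force this function to vanish.
  have hX := memXSO_cutoff (N := 4) (by norm_num)
  have h := hX.weightedIntegral_le_Sbar hs₂ hs hs₁
  rw [← h0, Real.zero_rpow (by linarith), zero_mul] at h
  have hz := hX.ae_eq_zero (hs₂.trans hs.le) hs₁ (h.antisymm (weightedIntegral_nonneg _))
  have hz' : cutoff 4 = 0 :=
    ((contDiff_cutoff 4).continuous.ae_eq_iff_eq volume continuous_zero).1 hz
  have h1 := congrFun hz' (EuclideanSpace.single 0 1)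
  have h2 : 0 < cutoff 4 (EuclideanSpace.single 0 1) :=
    mul_pos (Real.smoothTransition.pos_of_pos (by simp))
      (Real.smoothTransition.pos_of_pos (by simp; norm_num))
  exact h2.ne' h1

theorem lambdaStar_neg {s₁ s₂ : ℝ} (hs₂ : 0 ≤ s₂) (hs : s₂ < s₁) (hs₁ : s₁ < 2) :
    lambdaStar s₁ s₂ < 0 := by
  have hS := Sbar_pos hs₂ hs hs₁
  have h1 : 0 < (2 - s₁) / (2 - s₂) := div_pos (by linarith) (by linarith)
  have h2 : 0 < (s₁ - s₂) / (2 - s₂) := div_pos (by linarith) (by linarith)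
  rw [lambdaStar, neg_mul, neg_mul, neg_lt_zero]
  positivity

/-- Weighted Young inequality; it uses `θ B ≤ 1`. -/
theorem mul_rpow_le_add {θ B E W : ℝ} (hθ0 : 0 < θ) (hθ1 : θ < 1) (hB0 : 0 < B) (hB1 : B ≤ 1)
    (hE : 0 ≤ E) (hW : 0 ≤ W) :
    B * (E ^ θ * W ^ (1 - θ)) ≤ E + (1 - θ) * B * (θ * B) ^ ((1 - θ) * θ) * W := by
  have hθ' : 0 < 1 - θ := by linarith
  have hθB : 0 < θ * B := mul_pos hθ0 hB0
  -- The two numbers are `E/θ` and `B (θB)^{(1-θ)θ} W`, chosen so that their weighted sum is exactly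
  -- the right-hand side.
  have h := Real.geom_mean_le_arith_mean2_weighted hθ0.le hθ'.le (div_nonneg hE hθ0.le)
    (p₂ := B * (θ * B) ^ ((1 - θ) * θ) * W) (by positivity) (by ring)
  rw [mul_div_cancel₀ _ hθ0.ne'] at h
  refine le_trans ?_ (h.trans (le_of_eq (by ring)))
  rw [Real.div_rpow hE hθ0.le, Real.mul_rpow (by positivity) hW, Real.mul_rpow hB0.le (by positivity),
    ← Real.rpow_mul hθB.le]
  have hEW : 0 ≤ E ^ θ * W ^ (1 - θ) := by positivity
  suffices hs : B ≤ (θ ^ θ)⁻¹ * (B ^ (1 - θ) * (θ * B) ^ ((1 - θ) * θ * (1 - θ))) by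
    calc _ ≤ (θ ^ θ)⁻¹ * (B ^ (1 - θ) * (θ * B) ^ ((1 - θ) * θ * (1 - θ))) *
          (E ^ θ * W ^ (1 - θ)) := by gcongr
      _ = _ := by ring
  -- The base is at most `1` and `θ(1-θ)² ≤ θ`. The sharp constant would make the two exponents
  -- equal.
  have h1 : (θ * B) ^ θ ≤ (θ * B) ^ ((1 - θ) * θ * (1 - θ)) := by
    refine Real.rpow_le_rpow_of_exponent_ge hθB (by nlinarith) ?_
    nlinarith [mul_pos hθ0 hθ', mul_pos hθ0 hθ0]
  calc B = (θ ^ θ)⁻¹ * (B ^ (1 - θ) * (θ * B) ^ θ) := by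
        rw [Real.mul_rpow hθ0.le hB0.le, mul_left_comm (B ^ (1 - θ)), ← Real.rpow_add hB0,
          inv_mul_cancel_left₀ (by positivity)]
        simp
    _ ≤ _ := by gcongr

/-- The inequality that defines `λ*`. -/
theorem MemXSO.weightedIntegral_le_energy_sub {u : E3 → ℝ} {G : Fin 3 → E3 → ℝ} (h : MemXSO u G)
    {s₁ s₂ : ℝ} (hs₂ : 0 ≤ s₂) (hs : s₂ < s₁) (hs₁ : s₁ < 2) :
    weightedIntegral s₁ u ≤ energy u G - lambdaStar s₁ s₂ * weightedIntegral s₂ u := by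
  have hS := Sbar_pos hs₂ hs hs₁
  have e : 0 < 2 - s₂ := by linarith
  have hθ : 1 - (s₁ - s₂) / (2 - s₂) = (2 - s₁) / (2 - s₂) := by field_simp; ring
  have h1 := mul_rpow_le_add (θ := (s₁ - s₂) / (2 - s₂)) (B := Sbar s₁ s₂ ^ (6 - 2 * s₁))
    (div_pos (by linarith) e) ((div_lt_one e).2 (by linarith)) (by positivity)
    (Real.rpow_le_one hS.le (Sbar_le_one hs₂ hs hs₁) (by linarith))
    (energy_nonneg (u := u) (G := G)) (weightedIntegral_nonneg (u := u) s₂)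
  rw [hθ] at h1
  refine (h.weightedIntegral_le_Sbar hs₂ hs hs₁).trans (h1.trans (le_of_eq ?_))
  rw [lambdaStar, show (2 - s₁) * (s₁ - s₂) / (2 - s₂) ^ 2 =
    (2 - s₁) / (2 - s₂) * ((s₁ - s₂) / (2 - s₂)) by field_simp]
  ring

/-! ### Testing the equation with the solution -/

section Testing

variable {U : E3 → E3}

theorem enorm_nonlinear_le {s : ℝ} (hs2 : s < 2) {x : E3} (hx : 0 < ‖x‖) (V W : E3) :
    ‖‖V‖ ^ (4 - 2 * s) / ‖x‖ ^ s * inner ℝ V W‖ₑ ≤ ‖V‖ₑ ^ (5 - 2 * s) * ‖W‖ₑ * ‖x‖ₑ⁻¹ ^ s := by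
  have h1 : ‖‖V‖ ^ (4 - 2 * s) / ‖x‖ ^ s * inner ℝ V W‖ ≤
      ‖V‖ ^ (5 - 2 * s) * ‖W‖ * (‖x‖ ^ s)⁻¹ := by
    rw [norm_mul, Real.norm_of_nonneg (by positivity)]
    calc _ ≤ ‖V‖ ^ (4 - 2 * s) / ‖x‖ ^ s * (‖V‖ * ‖W‖) := by
          gcongr; exact norm_inner_le_norm V W
      _ = ‖V‖ ^ (4 - 2 * s) * ‖V‖ ^ (1 : ℝ) * ‖W‖ * (‖x‖ ^ s)⁻¹ := by
          rw [Real.rpow_one]; ring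
      _ = _ := by
          rw [← Real.rpow_add_of_nonneg (norm_nonneg _) (by linarith) zero_le_one]
          congr 3; ring
  rw [enorm_weight hx, ← ofReal_norm V, ← ofReal_norm W,
    ENNReal.ofReal_rpow_of_nonneg (norm_nonneg _) (by linarith),
    ← ENNReal.ofReal_mul (by positivity), ← ENNReal.ofReal_mul (by positivity), ← ofReal_norm]
  exact ENNReal.ofReal_le_ofReal h1

theorem lintegral_nonlinear_le {s : ℝ} (hs0 : 0 ≤ s) (hs2 : s < 2)
    (hU : AEStronglyMeasurable U volume) {V : E3 → E3} (hV : AEStronglyMeasurable V volume) :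
    ∫⁻ x, ‖‖U x‖ ^ (4 - 2 * s) / ‖x‖ ^ s * inner ℝ (U x) (V x)‖ₑ ≤
      weightedLIntegral s (fun x => ‖U x‖ₑ) ^ ((5 - 2 * s) / (6 - 2 * s)) *
        weightedLIntegral s (fun x => ‖V x‖ₑ) ^ (1 / (6 - 2 * s)) := by
  refine (lintegral_mono_ae ?_).trans (lintegral_weighted_mul_le hs2 hs0 hU.enorm hV.enorm)
  filter_upwards [ae_norm_pos] with x hx using enorm_nonlinear_le hs2 hx _ _

theorem integrable_nonlinear {s : ℝ} (hs0 : 0 ≤ s) (hs2 : s < 2)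
    (hU : AEStronglyMeasurable U volume) (hUw : weightedLIntegral s (fun x => ‖U x‖ₑ) < ⊤)
    {V : E3 → E3} (hV : AEStronglyMeasurable V volume)
    (hVw : weightedLIntegral s (fun x => ‖V x‖ₑ) < ⊤) :
    Integrable fun x => ‖U x‖ ^ (4 - 2 * s) / ‖x‖ ^ s * inner ℝ (U x) (V x) := by
  refine ⟨(((hU.norm.aemeasurable.pow_const _).div
    (measurable_norm.pow_const _).aemeasurable).aestronglyMeasurable).mul (hU.inner hV), ?_⟩
  refine (lintegral_nonlinear_le hs0 hs2 hU hV).trans_lt (ENNReal.mul_lt_top ?_ ?_)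
  · exact ENNReal.rpow_lt_top_of_nonneg (div_nonneg (by linarith) (by linarith)) hUw.ne
  · exact ENNReal.rpow_lt_top_of_nonneg (div_nonneg zero_le_one (by linarith)) hVw.ne

/-- The error is the nonlinear term paired with `Φ n - U`. Hölder and `weightedLIntegral_le` bound
it by a fixed finite constant times `ε n`. -/
theorem tendsto_integral_nonlinear {s : ℝ} (hs0 : 0 ≤ s) (hs2 : s < 2) (h6 : MemLp U 6 volume)
    (h2 : MemLp (fun x => (axisDist x)⁻¹ • U x) 2 volume) {Φ : ℕ → E3 → E3}
    (hΦ : ∀ n, AEStronglyMeasurable (Φ n) volume) {ε : ℕ → ℝ≥0∞} (hε : Tendsto ε atTop (𝓝 0))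
    (hε' : ∀ n, ε n ≠ ⊤)
    (hΦ6 : ∀ n, eLpNorm (fun x => Φ n x - U x) 6 volume ≤ ε n)
    (hΦ2 : ∀ n, eLpNorm (fun x => (axisDist x)⁻¹ • (Φ n x - U x)) 2 volume ≤ ε n) :
    Tendsto (fun n => ∫ x, ‖U x‖ ^ (4 - 2 * s) / ‖x‖ ^ s * inner ℝ (U x) (Φ n x)) atTop
      (𝓝 (∫ x, ‖U x‖ ^ (4 - 2 * s) / ‖x‖ ^ s * inner ℝ (U x) (U x))) := by
  have h0 : 0 < 6 - 2 * s := by linarith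
  have hUw := weightedLIntegral_lt_top hs0 hs2 h6 h2
  have hd (n : ℕ) : AEStronglyMeasurable (fun x => Φ n x - U x) volume := (hΦ n).sub h6.1
  have hdw (n : ℕ) := weightedLIntegral_le hs0 hs2 (hd n) (hΦ6 n) (hΦ2 n)
  have hUU := integrable_nonlinear hs0 hs2 h6.1 hUw h6.1 hUw
  have hUd (n : ℕ) := integrable_nonlinear hs0 hs2 h6.1 hUw (hd n)
    ((hdw n).trans_lt (ENNReal.rpow_lt_top_of_nonneg h0.le (hε' n)))
  refine tendsto_integral_of_L1 _ hUU.1 (Eventually.of_forall fun n => ?_) ?_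
  · refine (hUU.add (hUd n)).congr (Eventually.of_forall fun x => ?_)
    simp only [Pi.add_apply, inner_sub_right]
    ring
  · have hlim := ENNReal.Tendsto.const_mul hε (Or.inr (ENNReal.rpow_lt_top_of_nonneg
      (y := (5 - 2 * s) / (6 - 2 * s)) (div_nonneg (by linarith) h0.le) hUw.ne).ne)
    rw [mul_zero] at hlim
    refine tendsto_of_tendsto_of_tendsto_of_le_of_le tendsto_const_nhds hlim (fun _ => zero_le)
      fun n => ?_
    have heq (x : E3) : ‖U x‖ ^ (4 - 2 * s) / ‖x‖ ^ s * inner ℝ (U x) (Φ n x) -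
        ‖U x‖ ^ (4 - 2 * s) / ‖x‖ ^ s * inner ℝ (U x) (U x) =
        ‖U x‖ ^ (4 - 2 * s) / ‖x‖ ^ s * inner ℝ (U x) (Φ n x - U x) := by
      rw [inner_sub_right]; ring
    simp only [heq]
    refine (lintegral_nonlinear_le hs0 hs2 h6.1 (hd n)).trans ?_
    gcongr
    calc _ ≤ (ε n ^ (6 - 2 * s)) ^ (1 / (6 - 2 * s)) :=
          ENNReal.rpow_le_rpow (hdw n) (one_div_pos.2 h0).le
      _ = ε n := by rw [← ENNReal.rpow_mul, mul_one_div_cancel h0.ne', ENNReal.rpow_one]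

theorem tendsto_integral_inner_curl {G : Fin 3 → E3 → E3} (hG : ∀ j, MemLp (G j) 2 volume)
    {H : ℕ → Fin 3 → E3 → E3} (hH : ∀ n j, MemLp (H n j) 2 volume)
    (hlim : ∀ j, Tendsto (fun n => eLpNorm (fun x => H n j x - G j x) 2 volume) atTop (𝓝 0)) :
    Tendsto (fun n => ∫ x, inner ℝ (curl G x) (curl (H n) x)) atTop
      (𝓝 (∫ x, inner ℝ (curl G x) (curl G x))) := by
  have hcoord (a i : Fin 3) :
      Tendsto (fun n => eLpNorm (fun x => H n a x i - G a x i) 2 volume) atTop (𝓝 0) :=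
    tendsto_of_tendsto_of_tendsto_of_le_of_le tendsto_const_nhds (hlim a) (fun _ => zero_le)
      fun n => eLpNorm_mono_ae (Eventually.of_forall fun x => abs_coord_le_norm (H n a x - G a x) i)
  have hdiff (a i b k : Fin 3) : Tendsto (fun n => eLpNorm (fun x => (H n a x i - H n b x k) -
      (G a x i - G b x k)) 2 volume) atTop (𝓝 0) := by
    have h := (hcoord a i).add (hcoord b k)
    rw [add_zero] at h
    refine tendsto_of_tendsto_of_tendsto_of_le_of_le tendsto_const_nhds h (fun _ => zero_le)
      fun n => ?_
    refine le_trans (le_of_eq ?_) (eLpNorm_sub_le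
      ((memLp_coord (hH n a) i).sub (memLp_coord (hG a) i)).1
      ((memLp_coord (hH n b) k).sub (memLp_coord (hG b) k)).1 (by norm_num))
    congr 1; funext x; simp only [Pi.sub_apply]; ring
  have hc (i : Fin 3) :
      Tendsto (fun n => eLpNorm (fun x => curl (H n) x i - curl G x i) 2 volume) atTop (𝓝 0) := by
    fin_cases i
    · exact hdiff 1 2 2 1
    · exact hdiff 2 0 0 2
    · exact hdiff 0 1 1 0
  have ht (i : Fin 3) : Tendsto (fun n => ∫ x, curl G x i * curl (H n) x i) atTop
      (𝓝 (∫ x, curl G x i * curl G x i)) :=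
    tendsto_integral_mul (p := 2) (q := 2) (fn := fun _ x => curl G x i) (memLp_curl hG i)
      (memLp_curl hG i) (fun _ => memLp_curl hG i) (fun n => memLp_curl (hH n) i) (by simp) (hc i)
  have hsplit {K : Fin 3 → E3 → E3} (hK : ∀ j, MemLp (K j) 2 volume) :
      ∫ x, inner ℝ (curl G x) (curl K x) = (∫ x, curl G x 0 * curl K x 0) +
        (∫ x, curl G x 1 * curl K x 1) + ∫ x, curl G x 2 * curl K x 2 := by
    have hi (i : Fin 3) : Integrable fun x => curl G x i * curl K x i :=
      memLp_one_iff_integrable.1 ((memLp_curl hK i).smul (r := 1) (memLp_curl hG i))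
    have h01 : Integrable fun x => curl G x 0 * curl K x 0 + curl G x 1 * curl K x 1 :=
      (hi 0).add (hi 1)
    rw [← integral_add (hi 0) (hi 1), ← integral_add h01 (hi 2)]
    simp only [inner_eq_sum]
  rw [hsplit hG]
  exact (((ht 0).add (ht 1)).add (ht 2)).congr fun n => (hsplit (hH n)).symm

/-- A weak solution with `|U|/|x'|` in `L²` may be used as a test function. -/
theorem integral_inner_curl_eq_of_weak {s₁ s₂ lam : ℝ} (hs₁0 : 0 ≤ s₁) (hs₁ : s₁ < 2)
    (hs₂0 : 0 ≤ s₂) (hs₂ : s₂ < 2) {G : Fin 3 → E3 → E3} (h : HasD12Gradient U G)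
    (hr : MemLp (fun x => (axisDist x)⁻¹ • U x) 2 volume)
    (hw : ∀ Φ : E3 → E3, ContDiff ℝ ∞ Φ → HasCompactSupport Φ →
      ∫ x, inner ℝ (curl G x) (curl (partialDeriv Φ) x) =
        (∫ x, ‖U x‖ ^ (4 - 2 * s₁) / ‖x‖ ^ s₁ * inner ℝ (U x) (Φ x)) +
          lam * ∫ x, ‖U x‖ ^ (4 - 2 * s₂) / ‖x‖ ^ s₂ * inner ℝ (U x) (Φ x)) :
    ∫ x, inner ℝ (curl G x) (curl G x) =
      (∫ x, ‖U x‖ ^ (4 - 2 * s₁) / ‖x‖ ^ s₁ * inner ℝ (U x) (U x)) +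
        lam * ∫ x, ‖U x‖ ^ (4 - 2 * s₂) / ‖x‖ ^ s₂ * inner ℝ (U x) (U x) := by
  have hε : Tendsto (fun n : ℕ => ((n : ℝ≥0∞) + 1)⁻¹) atTop (𝓝 0) := by
    have := ENNReal.tendsto_inv_nat_nhds_zero.comp (tendsto_add_atTop_nat 1)
    simpa [Function.comp_def] using this
  have hεtop (n : ℕ) : ((n : ℝ≥0∞) + 1)⁻¹ ≠ ⊤ := by simp
  choose Φ hΦ hΦc _ h6 h2 h2' using fun n : ℕ =>
    h.exists_approx_offAxis hr (ε := ((n : ℝ≥0∞) + 1)⁻¹) (by simp [ENNReal.inv_pos])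
  have hm (n : ℕ) : AEStronglyMeasurable (Φ n) volume := (hΦ n).continuous.aestronglyMeasurable
  have t1 := tendsto_integral_nonlinear hs₁0 hs₁ h.1 hr hm hε hεtop h6 h2'
  have t2 := tendsto_integral_nonlinear hs₂0 hs₂ h.1 hr hm hε hεtop h6 h2'
  have t3 := tendsto_integral_inner_curl h.2.1 (H := fun n => partialDeriv (Φ n))
    (fun n j => (contDiff_partialDeriv (hΦ n) j).continuous.memLp_of_hasCompactSupport
      (hasCompactSupport_partialDeriv (hΦc n) j))
    (fun j => tendsto_of_tendsto_of_tendsto_of_le_of_le tendsto_const_nhds hε (fun _ => zero_le)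
      fun n => h2 n j)
  exact tendsto_nhds_unique t3 ((t1.add (t2.const_mul lam)).congr fun n =>
    (hw (Φ n) (hΦ n) (hΦc n)).symm)

theorem integral_nonlinear_self {u : E3 → ℝ} {s : ℝ} (hs : s < 2) (hn : ∀ᵐ x, ‖U x‖ = |u x|) :
    ∫ x, ‖U x‖ ^ (4 - 2 * s) / ‖x‖ ^ s * inner ℝ (U x) (U x) = weightedIntegral s u := by
  refine integral_congr_ae ?_
  filter_upwards [hn] with x hx
  rw [real_inner_self_eq_norm_sq, hx, div_mul_eq_mul_div, ← Real.rpow_natCast,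
    ← Real.rpow_add_of_nonneg (abs_nonneg _) (by linarith) (by positivity)]
  congr 2
  push_cast
  ring

end Testing

/-! ### The Liouville type theorem -/

theorem hasD12Gradient_zero {F : Type*} [NormedAddCommGroup F] [NormedSpace ℝ F] :
    HasD12Gradient (0 : E3 → F) 0 :=
  ⟨MemLp.zero, fun _ => MemLp.zero, fun _ => 0, fun _ => ⟨contDiff_const, HasCompactSupport.zero⟩,
    by simp, fun j => by simp [partialDeriv]⟩

theorem memDF_zero : MemDF 0 :=
  ⟨⟨0, hasD12Gradient_zero⟩, 0, fun _ _ _ => rfl, Eventually.of_forall fun x => by simp⟩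

theorem isWeakSolution_zero (s₁ s₂ lam : ℝ) : IsWeakSolution s₁ s₂ lam 0 := by
  refine ⟨0, hasD12Gradient_zero, fun Φ _ _ => ?_⟩
  have h (x : E3) : curl 0 x = 0 := by
    ext i; fin_cases i <;> simp [curl]
  simp [h]

theorem ae_eq_zero_of_isWeakSolution {s₁ s₂ lam : ℝ} (hs₂ : 0 ≤ s₂) (hs : s₂ < s₁) (hs₁ : s₁ < 2)
    (hlam : lam < lambdaStar s₁ s₂) {U : E3 → E3} (hU : MemDF U)
    (hw : IsWeakSolution s₁ s₂ lam U) : U =ᵐ[volume] 0 := by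
  -- The gradient is taken from the weak formulation, so no comparison of two gradients is needed.
  obtain ⟨-, u, hu, hUu⟩ := hU
  obtain ⟨G, hG, hweak⟩ := hw
  have hX := hG.memXSO_of_toroidal hu hUu
  have hn := norm_ae_eq_of_toroidal hUu
  have hr := hG.memLp_div_axisDist_of_toroidal hu hUu
  have hE := hG.energy_le_of_toroidal hu hUu
  rw [integral_inner_curl_eq_of_weak (by linarith) hs₁ hs₂ (by linarith) hG hr hweak,
    integral_nonlinear_self hs₁ hn, integral_nonlinear_self (by linarith) hn] at hE
  have hY := hX.weightedIntegral_le_energy_sub hs₂ hs hs₁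
  have hW := weightedIntegral_nonneg (u := u) s₂
  -- The inequalities `hE` and `hY` add up to `0 ≤ (lam - λ*) W₂`, whose first factor is negative.
  have hW0 : weightedIntegral s₂ u = 0 := by
    refine le_antisymm ?_ hW
    by_contra! hpos
    nlinarith [mul_pos (sub_pos.2 hlam) hpos]
  filter_upwards [hX.ae_eq_zero hs₂ (by linarith) hW0, hn] with x hx hnx
  rw [hx] at hnx
  simpa using hnx

end Maxwell

end

theorem theorem1p4 (s₁ s₂ : ℝ) (hs₂ : 0 ≤ s₂) (hs : s₂ < s₁) (hs₁ : s₁ < 2) :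
    IsLeast (Maxwell.cknConstants s₁ s₂) (Maxwell.Sbar s₁ s₂) ∧
    Maxwell.lambdaStar s₁ s₂ < 0 ∧
    ∀ lam : ℝ, lam < Maxwell.lambdaStar s₁ s₂ →
      (Maxwell.MemDF 0 ∧ Maxwell.IsWeakSolution s₁ s₂ lam 0) ∧
      ∀ U : Maxwell.E3 → Maxwell.E3, Maxwell.MemDF U →
        Maxwell.IsWeakSolution s₁ s₂ lam U → U =ᵐ[volume] 0 :=
  ⟨Maxwell.isLeast_Sbar hs₂ hs hs₁, Maxwell.lambdaStar_neg hs₂ hs hs₁, fun lam hlam =>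
    ⟨⟨Maxwell.memDF_zero, Maxwell.isWeakSolution_zero s₁ s₂ lam⟩, fun _ hU hw =>
      Maxwell.ae_eq_zero_of_isWeakSolution hs₂ hs hs₁ hlam hU hw⟩⟩
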